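/- **Ground types and effect theories.** Fix a set of base types $b$ and a set of operation symbols $\mathtt{op}$. Ground types are $\hat A ::= b \mid \hat A_1\times\dots\times\hat A_n \mid \hat A_1+\dots+\hat A_n$ ($n\ge 0$), and ground terms are $\hat V ::= x\mid\langle\hat V_1,\dots,\hat V_n\rangle\mid\pi_i\,\hat V\mid\iota_i\,\hat V$, with the usual typing $\hat\Delta\vdash\hat V:\hat A$. A signature $\Sigma$ is a finite partial function assigning to operation symbols pairs of ground types, written $(\mathtt{op}:\hat A_{\mathtt{op}}\rightarrowtriangle\hat B_{\mathtt{op}})\in\Sigma$. Effect theory terms $\hat\Delta\vdash\hat M:\hat A!\Sigma$ are $\hat M::=\mathtt{return}\,\hat V\mid \mathtt{let}\,x=\mathtt{op}(\hat V)\,\mathtt{in}\,\hat M\mid\mathtt{case}\,\hat V\,\mathtt{of}\,\{\iota_i\,x_i\mapsto\hat M_i\}_{i=1}^n$ with the evident typing. An effect theory is a pair $\mathcal T=(\Sigma,\mathcal E)$ of a signature and a set $\mathcal E$ of equational axioms $\hat\Delta\vdash\hat M\sim\hat N:\hat A!\Sigma$, i.e. pairs of well-typed effect theory terms with the same context and type.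 **The calculus $\lambda_{\mathrm{eff}}^{E}$.** Value types are $A,B::=b\mid A\to C\mid A_1\times\dots\times A_n\mid A_1+\dots+A_n$ and computation types are $C::=A!\Sigma/\mathcal E$. Terms, which are identified with their simple type derivations and taken up to renaming of bound variables, are $$V,W::=x\mid\lambda x.M\mid\langle V_1,\dots,V_n\rangle\mid\pi_i\,V\mid\iota_i\,V,$$ $$M,N::=V\,W\mid\mathtt{return}\,V\mid\mathtt{let}\,x=M\,\mathtt{in}\,N\mid\mathtt{op}(V)\mid\mathtt{case}\,V\,\mathtt{of}\,\{\iota_i\,x_i\mapsto M_i\}_{i=1}^n\mid\mathtt{handle}\,M\,\mathtt{with}\,H\,\{x.N\}.$$ A handler $H$ of type $\Sigma\Rightarrow C$ consists of one clause $\mathtt{op}(x,k)\mapsto M_{\mathtt{op}}$ for each $\mathtt{op}\in\Sigma$, with $\Gamma,x:\hat A_{\mathtt{op}},k:\hat B_{\mathtt{op}}\to C\vdash M_{\mathtt{op}}:C$. The typing rules are the standard ones of fine-grain call-by-value, with $\mathtt{op}(V):\hat B_{\mathtt{op}}!\Sigma/\mathcal E$ for $V:\hat A_{\mathtt{op}}$,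 except that $\Gamma\vdash\mathtt{handle}\,M\,\mathtt{with}\,H\,\{x.N\}:C$ requires $\Gamma\vdash M:A!\Sigma/\mathcal E$, $\Gamma,x:A\vdash N:C$ and $\Gamma\vdash H:\Sigma\Rightarrow C\ \mathbf{respects}\ \mathcal E$. The last judgement means that $\Gamma\vdash H:\Sigma\Rightarrow C$ and that $\Gamma,\hat\Delta,k:\hat A\to C\vdash\hat M[H,k]=\hat N[H,k]:C$ is derivable for every axiom $\hat\Delta\vdash\hat M\sim\hat N:\hat A!\Sigma$ in $\mathcal E$. Here $(\mathtt{return}\,\hat V)[H,k]=k\,\hat V$, $(\mathtt{let}\,x=\mathtt{op}(\hat V)\,\mathtt{in}\,\hat N)[H,k]=M_{\mathtt{op}}[\hat V/x,\lambda x.\hat N[H,k]/k']$ where $\mathtt{op}(x,k')\mapsto M_{\mathtt{op}}$ is the clause of $H$, and $(-)[H,k]$ commutes with $\mathtt{case}$. Simultaneously with typing, the judgements $\Gamma\vdash V=W:A$, $\Gamma\vdash M=N:C$ and $\Gamma\vdash H=H':\Sigma\Rightarrow C$ are generated by reflexivity (for well-typed terms), symmetry, transitivity, congruence for every term former (for $\mathtt{handle}$,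 the handler on the left respects $\mathcal E$), and the following equations, each under the hypothesis that its constituents are well-typed and that the handlers occurring in $\mathtt{handle}$ respect the axioms: - $\beta/\eta$ for functions, products and sums: $(\lambda x.M)\,V=M[V/x]$, $V=\lambda x.(V\,x)$, $\pi_i\langle V_1,\dots,V_n\rangle=V_i$, $V=\langle\pi_1V,\dots,\pi_nV\rangle$, $\mathtt{case}\ \iota_i V\ \mathtt{of}\ \{\iota_j\,x\mapsto M_j\}_j=M_i[V/x]$, $\mathtt{case}\ V\ \mathtt{of}\ \{\iota_i\,y\mapsto M[\iota_i\,y/x]\}_i=M[V/x]$; - $\mathtt{let}\,x=\mathtt{return}\,V\,\mathtt{in}\,M=M[V/x]$, $\mathtt{let}\,x=M\,\mathtt{in}\,\mathtt{return}\,x=M$, and $\mathtt{let}\,y=(\mathtt{let}\,x=M\,\mathtt{in}\,N)\,\mathtt{in}\,L=\mathtt{let}\,x=M\,\mathtt{in}\,\mathtt{let}\,y=N\,\mathtt{in}\,L$; - $\mathtt{handle}\,\mathtt{return}\,V\,\mathtt{with}\,H\,\{x.M\}=M[V/x]$; $\ \mathtt{handle}\,(\mathtt{let}\,x=L\,\mathtt{in}\,M)\,\mathtt{with}\,H\,\{y.N\}=\mathtt{handle}\,L\,\mathtt{with}\,H\,\{x.\,\mathtt{handle}\,M\,\mathtt{with}\,H\,\{y.N\}\}$;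 $\ \mathtt{handle}\,\mathtt{op}(V)\,\mathtt{with}\,H\,\{x.M\}=M_{\mathtt{op}}[V/x,\lambda x.M/k]$; - $\Gamma\vdash\hat M[\sigma]=\hat N[\sigma]:\hat A!\Sigma/\mathcal E$ for each axiom $\hat\Delta\vdash\hat M\sim\hat N:\hat A!\Sigma$ in $\mathcal E$ and each well-typed substitution $\sigma:\Gamma\to\hat\Delta$. **Models.** For a strong monad $T$ on a cartesian category $\mathcal C$, a Kleisli exponential $Y\Rightarrow_T Z$ is an object with an isomorphism $\Lambda:\mathcal C(X\times Y,TZ)\cong\mathcal C(X,Y\Rightarrow_TZ)$ natural in $X$, and $\mathrm{ev}=\Lambda^{-1}(\mathrm{id})$. A diagram $(\iota_i:X_i\to P)_{i=1}^n$ is a Kleisli coproduct if for all $f_i:X_i\to TY$ there is a unique $g:P\to TY$ with $g\circ\iota_i=f_i$ for all $i$; it is distributive if moreover every $Z\times(-)$ maps it to a Kleisli coproduct. A $\lambda_{\mathrm{eff}}^{E}$-model consists of: 1. a cartesian category $\mathcal C$ with strong monads $T_{\mathcal T}$ indexed by effect theories, Kleisli exponentials for each $T_{\mathcal T}$, for every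 finite family of objects a diagram that is a distributive Kleisli coproduct for all $T_{\mathcal T}$ at once, and an object $[\![b]\!]$ for each base type. Types are then interpreted by products, these coproducts, and $[\![A\to B!\Sigma/\mathcal E]\!]=[\![A]\!]\Rightarrow_{T_{(\Sigma,\mathcal E)}}[\![B]\!]$; contexts are interpreted by products, and ground terms in the evident way. 2. for each $\mathcal T=(\Sigma,\mathcal E)$ and $\mathtt{op}\in\Sigma$ a morphism $[\![\mathtt{op}]\!]_{\mathcal T}:[\![\hat A_{\mathtt{op}}]\!]\to T_{\mathcal T}[\![\hat B_{\mathtt{op}}]\!]$ such that $[\![\hat M]\!]=[\![\hat N]\!]$ for each axiom in $\mathcal E$, where $[\![\mathtt{return}\,\hat V]\!]=\eta\circ[\![\hat V]\!]$, $[\![\mathtt{let}\,x=\mathtt{op}(\hat V)\,\mathtt{in}\,\hat M]\!]=\mu\circ T[\![\hat M]\!]\circ\mathrm{str}\circ\langle\mathrm{id},[\![\mathtt{op}]\!]\circ[\![\hat V]\!]\rangle$ and $[\![\mathtt{case}\,\hat V\,\mathtt{of}\,\{\iota_i\,x_i\mapsto\hat M_i\}_i]\!]=[[\![\hat M_1]\!],\dots,[\![\hat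 M_n]\!]]\circ\langle\mathrm{id},[\![\hat V]\!]\rangle$. 3. for all effect theories $\mathcal T=(\Sigma,\mathcal E)$ and $\mathcal T'$ and every object $X$, a family $\mathbf{handle}_{\mathcal T,\mathcal T',X}(h,f):Z\to T_{\mathcal T'}X$, natural in $Z$, for $h\in H_{\mathcal T}(Z)$ and $f:Z\to T_{\mathcal T}T_{\mathcal T'}X$. Here $\mathrm{Hdl}_\Sigma(X)=\prod_{\mathtt{op}\in\Sigma}\bigl([\![\hat A_{\mathtt{op}}]\!]\times([\![\hat B_{\mathtt{op}}]\!]\Rightarrow_{T_{\mathcal T'}}X)\bigr)\Rightarrow_{T_{\mathcal T'}}X$, and $H_{\mathcal T}(Z)$ is the set of $h:Z\to\mathrm{Hdl}_\Sigma(X)$ with $(\!|\hat M|\!)\circ h=(\!|\hat N|\!)\circ h$ for each axiom in $\mathcal E$. The morphism $(\!|\hat M|\!):\mathrm{Hdl}_\Sigma(X)\to([\![\hat\Delta]\!]\times([\![\hat A]\!]\Rightarrow_{T_{\mathcal T'}}X))\Rightarrow_{T_{\mathcal T'}}X$ is defined by recursion: writing $(h,d,k)$ for the arguments, $\Lambda^{-1}(\!|\mathtt{return}\,\hat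 V|\!)$ applies $k$ to $[\![\hat V]\!](d)$, $\Lambda^{-1}(\!|\mathtt{let}\,x=\mathtt{op}(\hat V)\,\mathtt{in}\,\hat M|\!)$ applies $\pi_{\mathtt{op}}(h)$ to $[\![\hat V]\!](d)$ and the Kleisli function $x\mapsto\Lambda^{-1}(\!|\hat M|\!)(h,(d,x),k)$, and $\Lambda^{-1}(\!|\mathtt{case}\,\hat V\,\mathtt{of}\,\{\iota_i\,x_i\mapsto\hat M_i\}_i|\!)$ is the cotupling of the $\Lambda^{-1}(\!|\hat M_i|\!)(h,(d,x_i),k)$ at $[\![\hat V]\!](d)$. For $h\in H_{\mathcal T}(Z)$ and all $f$ of the appropriate types it is required that $$\mathbf{handle}(h,\eta\circ f)=f,\qquad \mathbf{handle}(h,\mu\circ f)=\mathbf{handle}\bigl(h,\,T_{\mathcal T}\mathbf{handle}(h\circ\pi_1,\pi_2)\circ\mathrm{str}\circ\langle\mathrm{id},f\rangle\bigr),$$ $$\mathbf{handle}\bigl(h,\,T_{\mathcal T}\mathrm{ev}\circ\mathrm{str}\circ\langle\pi_2,[\![\mathtt{op}]\!]_{\mathcal T}\circ\pi_1\rangle\circ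 f\bigr)=\mathrm{ev}\circ\langle\pi_{\mathtt{op}}\circ h,f\rangle .$$ **Partial interpretation.** In a model, values $\Gamma\vdash V:A$, computations $\Gamma\vdash M:A!\Sigma/\mathcal E$ and handlers $\Gamma\vdash H:\Sigma\Rightarrow B!\Sigma'/\mathcal E'$ have partial interpretations $[\![V]\!]:[\![\Gamma]\!]\to[\![A]\!]$, $[\![M]\!]:[\![\Gamma]\!]\to T_{(\Sigma,\mathcal E)}[\![A]\!]$ and $[\![H]\!]:[\![\Gamma]\!]\to\mathrm{Hdl}_\Sigma([\![B]\!])$ (formed with $T_{(\Sigma',\mathcal E')}$), defined by recursion on type derivations. All clauses are the standard ones and are defined when the interpretations of the immediate subterms are ($\lambda x.M$ by $\Lambda[\![M]\!]$, application by $\mathrm{ev}$, $\mathtt{return}$ by $\eta$, $\mathtt{let}$ by $\mu\circ T[\![N]\!]\circ\mathrm{str}\circ\langle\mathrm{id},[\![M]\!]\rangle$, $\mathtt{op}(V)$ by $[\![\mathtt{op}]\!]\circ[\![V]\!]$, $\mathtt{case}$ by cotupling, handlers by tupling the curried clauses), except that $$[\![\mathtt{handle}\,M\,\mathtt{with}\,H\,\{x.N\}]\!]=\mathbf{handle}_{\mathcal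 T,\mathcal T',[\![B]\!]}\bigl([\![H]\!],\,T_{\mathcal T}[\![N]\!]\circ\mathrm{str}\circ\langle\mathrm{id},[\![M]\!]\rangle\bigr)\quad\text{if }[\![H]\!]\in H_{\mathcal T}([\![\Gamma]\!]),$$ and it is undefined otherwise. **Theorem.** In every $\lambda_{\mathrm{eff}}^{E}$-model: 1. If $\Gamma\vdash V:A$, $\Gamma\vdash M:A!\Sigma/\mathcal E$ or $\Gamma\vdash H:\Sigma\Rightarrow C$ is derivable, then $[\![V]\!]$, $[\![M]\!]$ or $[\![H]\!]$, respectively, is defined. 2. If $\Gamma\vdash M=N:A!\Sigma/\mathcal E$ is derivable, then $[\![M]\!]$ and $[\![N]\!]$ are defined and $[\![M]\!]=[\![N]\!]$. The same holds for derivable equations $\Gamma\vdash V=W:A$ between value terms and $\Gamma\vdash H=H':\Sigma\Rightarrow C$ between handlers. -/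

import Mathlib

open CategoryTheory CategoryTheory.Limits MonoidalCategory CartesianMonoidalCategory

universe u₁ u₂ v u w

namespace EffHandlers

/-! ## Ground types, ground terms, signatures and effect theories

`Op` is the set of operation symbols and `Base` is the set of base types.  Terms are well-scoped
and intrinsically typed (de Bruijn): a context is a list of types whose head is the most recently
bound variable, and a term is the same thing as its (simple) type derivation. -/

/-- De Bruijn variables: `Var Γ A` is the set of variables of type `A` in the context `Γ`. -/
inductive Var {α : Type w} : List α → α → Type w
  | here {Γ : List α} {A : α} : Var (A :: Γ) A
  | there {Γ : List α} {A B : α} : Var Γ A → Var (B :: Γ) A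

/-- Ground types: base types and finite (possibly nullary) products and sums of ground types. -/
inductive GTy (Base : Type u₂) : Type u₂
  | base (b : Base) : GTy Base
  | prod (n : ℕ) (A : Fin n → GTy Base) : GTy Base
  | sum (n : ℕ) (A : Fin n → GTy Base) : GTy Base

/-- Ground terms in context. -/
inductive GTm {Base : Type u₂} (Δ : List (GTy Base)) : GTy Base → Type u₂
  | var {A : GTy Base} (x : Var Δ A) : GTm Δ A
  | tuple {n : ℕ} {A : Fin n → GTy Base} (V : ∀ i, GTm Δ (A i)) : GTm Δ (.prod n A)
  | proj {n : ℕ} {A : Fin n → GTy Base} (i : Fin n) (V : GTm Δ (.prod n A)) : GTm Δ (A i)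
  | inj {n : ℕ} {A : Fin n → GTy Base} (i : Fin n) (V : GTm Δ (A i)) : GTm Δ (.sum n A)

/-- Operation signatures: finite partial functions from operation symbols to pairs of ground
types (argument type and result type). -/
structure Sig (Op : Type u₁) (Base : Type u₂) : Type (max u₁ u₂) where
  ops : Finset Op
  arg : {o : Op // o ∈ ops} → GTy Base
  res : {o : Op // o ∈ ops} → GTy Base

/-- The operations of a signature. -/
abbrev Sig.Ops {Op : Type u₁} {Base : Type u₂} (S : Sig Op Base) : Type u₁ := {o : Op // o ∈ S.ops}

/-- Effect theory terms `Δ ⊢ M : A ! S`.  The constructor `letOp o V M` is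
`let x = o(V) in M`. -/
inductive ETm {Op : Type u₁} {Base : Type u₂} (S : Sig Op Base) :
    List (GTy Base) → GTy Base → Type (max u₁ u₂)
  | ret {Δ : List (GTy Base)} {A : GTy Base} (V : GTm Δ A) : ETm S Δ A
  | letOp {Δ : List (GTy Base)} {A : GTy Base} (o : S.Ops) (V : GTm Δ (S.arg o))
      (M : ETm S (S.res o :: Δ) A) : ETm S Δ A
  | case {Δ : List (GTy Base)} {B : GTy Base} {n : ℕ} {A : Fin n → GTy Base}
      (V : GTm Δ (.sum n A)) (M : ∀ i, ETm S (A i :: Δ) B) : ETm S Δ B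

/-- Equational axioms for a signature: pairs of terms with the same context and type. -/
structure Axm {Op : Type u₁} {Base : Type u₂} (S : Sig Op Base) : Type (max u₁ u₂) where
  ctx : List (GTy Base)
  ty : GTy Base
  lhs : ETm S ctx ty
  rhs : ETm S ctx ty

/-- Effect theories: a signature with a set of equational axioms. -/
structure EffTheory (Op : Type u₁) (Base : Type u₂) : Type (max u₁ u₂) where
  sig : Sig Op Base
  ax : Set (Axm sig)

/-! ## Types and terms of the calculus -/

/-- Value types.  `fn A B 𝒯` is the function type `A → B ! Σ/ℰ` with `𝒯 = (Σ, ℰ)`.  A computation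
type `B ! Σ/ℰ` is given by the pair of `B` and `𝒯`. -/
inductive VTy (Op : Type u₁) (Base : Type u₂) : Type (max u₁ u₂)
  | base (b : Base) : VTy Op Base
  | fn (A B : VTy Op Base) (𝒯 : EffTheory Op Base) : VTy Op Base
  | prod (n : ℕ) (A : Fin n → VTy Op Base) : VTy Op Base
  | sum (n : ℕ) (A : Fin n → VTy Op Base) : VTy Op Base

/-- Contexts. -/
abbrev Ctx (Op : Type u₁) (Base : Type u₂) : Type (max u₁ u₂) := List (VTy Op Base)

/-- Ground types are value types. -/
def GTy.toVTy {Base : Type u₂} (Op : Type u₁) : GTy Base → VTy Op Base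
  | .base b => .base b
  | .prod n A => .prod n fun i => (A i).toVTy Op
  | .sum n A => .sum n fun i => (A i).toVTy Op

section Terms

variable {Op : Type u₁} {Base : Type u₂}

mutual

/-- Simply typed value terms `Γ ⊢ V : A` (handlers are not yet required to respect axioms). -/
inductive Val : Ctx Op Base → VTy Op Base → Type (max u₁ u₂)
  | var {Γ : Ctx Op Base} {A : VTy Op Base} (x : Var Γ A) : Val Γ A
  | lam {Γ : Ctx Op Base} {A B : VTy Op Base} {𝒯 : EffTheory Op Base}
      (M : Comp (A :: Γ) B 𝒯) : Val Γ (.fn A B 𝒯)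
  | tuple {Γ : Ctx Op Base} {n : ℕ} {A : Fin n → VTy Op Base}
      (V : ∀ i, Val Γ (A i)) : Val Γ (.prod n A)
  | proj {Γ : Ctx Op Base} {n : ℕ} {A : Fin n → VTy Op Base} (i : Fin n)
      (V : Val Γ (.prod n A)) : Val Γ (A i)
  | inj {Γ : Ctx Op Base} {n : ℕ} {A : Fin n → VTy Op Base} (i : Fin n)
      (V : Val Γ (A i)) : Val Γ (.sum n A)

/-- Simply typed computation terms `Γ ⊢ M : A ! Σ/ℰ`, where `𝒯 = (Σ, ℰ)`.  In
`handle M H N`, which is `handle M with H {x. N}`, the handler `H` has one clause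
`op(x, k) ↦ H op` for each operation of the signature of `M`; in a clause `k` is the most recent
variable and `x` is the next one. -/
inductive Comp : Ctx Op Base → VTy Op Base → EffTheory Op Base → Type (max u₁ u₂)
  | app {Γ : Ctx Op Base} {A B : VTy Op Base} {𝒯 : EffTheory Op Base}
      (V : Val Γ (.fn A B 𝒯)) (W : Val Γ A) : Comp Γ B 𝒯
  | ret {Γ : Ctx Op Base} {A : VTy Op Base} {𝒯 : EffTheory Op Base}
      (V : Val Γ A) : Comp Γ A 𝒯
  | letIn {Γ : Ctx Op Base} {A B : VTy Op Base} {𝒯 : EffTheory Op Base}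
      (M : Comp Γ A 𝒯) (N : Comp (A :: Γ) B 𝒯) : Comp Γ B 𝒯
  | op {Γ : Ctx Op Base} {𝒯 : EffTheory Op Base} (o : 𝒯.sig.Ops)
      (V : Val Γ ((𝒯.sig.arg o).toVTy Op)) : Comp Γ ((𝒯.sig.res o).toVTy Op) 𝒯
  | case {Γ : Ctx Op Base} {n : ℕ} {A : Fin n → VTy Op Base} {B : VTy Op Base}
      {𝒯 : EffTheory Op Base} (V : Val Γ (.sum n A)) (M : ∀ i, Comp (A i :: Γ) B 𝒯) : Comp Γ B 𝒯
  | handle {Γ : Ctx Op Base} {A B : VTy Op Base} {𝒯 𝒯' : EffTheory Op Base}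
      (M : Comp Γ A 𝒯)
      (H : ∀ o : 𝒯.sig.Ops, Comp
        (.fn ((𝒯.sig.res o).toVTy Op) B 𝒯' :: (𝒯.sig.arg o).toVTy Op :: Γ) B 𝒯')
      (N : Comp (A :: Γ) B 𝒯') : Comp Γ B 𝒯'

end

/-- Handlers `Γ ⊢ H : S ⇒ B ! Σ'/ℰ'`, with `𝒯' = (Σ', ℰ')`: families of operation clauses. -/
abbrev Hdl (Γ : Ctx Op Base) (S : Sig Op Base) (B : VTy Op Base) (𝒯' : EffTheory Op Base) :
    Type (max u₁ u₂) :=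
  ∀ o : S.Ops, Comp (.fn ((S.res o).toVTy Op) B 𝒯' :: (S.arg o).toVTy Op :: Γ) B 𝒯'

/-! ### Renaming and substitution -/

/-- Renamings from `Γ` to `Δ`. -/
abbrev Ren (Γ Δ : Ctx Op Base) : Type (max u₁ u₂) := ∀ A : VTy Op Base, Var Γ A → Var Δ A

/-- Extension of a renaming under a binder. -/
def Ren.lift {Γ Δ : Ctx Op Base} (ρ : Ren Γ Δ) (B : VTy Op Base) : Ren (B :: Γ) (B :: Δ)
  | _, .here => .here
  | _, .there x => .there (ρ _ x)

mutual

/-- Renaming in value terms. -/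
def Val.ren : {Γ : Ctx Op Base} → {A : VTy Op Base} → Val Γ A →
    {Δ : Ctx Op Base} → Ren Γ Δ → Val Δ A
  | _, _, .var x, _, ρ => .var (ρ _ x)
  | _, _, .lam M, _, ρ => .lam (M.ren (ρ.lift _))
  | _, _, .tuple V, _, ρ => .tuple fun i => (V i).ren ρ
  | _, _, .proj (A := A) i V, _, ρ => .proj (A := A) i (V.ren ρ)
  | _, _, .inj (A := A) i V, _, ρ => .inj (A := A) i (V.ren ρ)

/-- Renaming in computation terms. -/
def Comp.ren : {Γ : Ctx Op Base} → {A : VTy Op Base} → {𝒯 : EffTheory Op Base} → Comp Γ A 𝒯 →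
    {Δ : Ctx Op Base} → Ren Γ Δ → Comp Δ A 𝒯
  | _, _, _, .app V W, _, ρ => .app (V.ren ρ) (W.ren ρ)
  | _, _, _, .ret V, _, ρ => .ret (V.ren ρ)
  | _, _, _, .letIn M N, _, ρ => .letIn (M.ren ρ) (N.ren (ρ.lift _))
  | _, _, _, .op o V, _, ρ => .op o (V.ren ρ)
  | _, _, _, .case V M, _, ρ => .case (V.ren ρ) fun i => (M i).ren (ρ.lift _)
  | _, _, _, .handle M H N, _, ρ =>
      .handle (M.ren ρ) (fun o => (H o).ren ((ρ.lift _).lift _)) (N.ren (ρ.lift _))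

end

/-- The weakening renaming. -/
def Ren.wk (Γ : Ctx Op Base) (B : VTy Op Base) : Ren Γ (B :: Γ) := fun _ x => .there x

/-- Renaming in handlers. -/
def Hdl.ren {Γ Δ : Ctx Op Base} {S : Sig Op Base} {B : VTy Op Base} {𝒯' : EffTheory Op Base}
    (H : Hdl Γ S B 𝒯') (ρ : Ren Γ Δ) : Hdl Δ S B 𝒯' :=
  fun o => (H o).ren ((ρ.lift _).lift _)

/-- Substitutions: `Sub Δ Γ` assigns to each variable of `Δ` a value term in the context `Γ`. -/
abbrev Sub (Δ Γ : Ctx Op Base) : Type (max u₁ u₂) := ∀ A : VTy Op Base, Var Δ A → Val Γ A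

/-- Extension of a substitution by a term for one more variable. -/
def Sub.cons {Δ Γ : Ctx Op Base} (σ : Sub Δ Γ) {B : VTy Op Base} (W : Val Γ B) : Sub (B :: Δ) Γ
  | _, .here => W
  | _, .there x => σ _ x

/-- The identity substitution. -/
def Sub.id (Γ : Ctx Op Base) : Sub Γ Γ := fun _ x => .var x

/-- Extension of a substitution under a binder. -/
def Sub.lift {Δ Γ : Ctx Op Base} (σ : Sub Δ Γ) (B : VTy Op Base) : Sub (B :: Δ) (B :: Γ) :=
  Sub.cons (fun _ x => (σ _ x).ren (Ren.wk Γ B)) (.var .here)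

mutual

/-- Substitution in value terms. -/
def Val.subst : {Δ : Ctx Op Base} → {A : VTy Op Base} → Val Δ A →
    {Γ : Ctx Op Base} → Sub Δ Γ → Val Γ A
  | _, _, .var x, _, σ => σ _ x
  | _, _, .lam M, _, σ => .lam (M.subst (σ.lift _))
  | _, _, .tuple V, _, σ => .tuple fun i => (V i).subst σ
  | _, _, .proj (A := A) i V, _, σ => .proj (A := A) i (V.subst σ)
  | _, _, .inj (A := A) i V, _, σ => .inj (A := A) i (V.subst σ)

/-- Substitution in computation terms. -/
def Comp.subst : {Δ : Ctx Op Base} → {A : VTy Op Base} → {𝒯 : EffTheory Op Base} → Comp Δ A 𝒯 →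
    {Γ : Ctx Op Base} → Sub Δ Γ → Comp Γ A 𝒯
  | _, _, _, .app V W, _, σ => .app (V.subst σ) (W.subst σ)
  | _, _, _, .ret V, _, σ => .ret (V.subst σ)
  | _, _, _, .letIn M N, _, σ => .letIn (M.subst σ) (N.subst (σ.lift _))
  | _, _, _, .op o V, _, σ => .op o (V.subst σ)
  | _, _, _, .case V M, _, σ => .case (V.subst σ) fun i => (M i).subst (σ.lift _)
  | _, _, _, .handle M H N, _, σ =>
      .handle (M.subst σ) (fun o => (H o).subst ((σ.lift _).lift _)) (N.subst (σ.lift _))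

end

/-- `M[V/x]` for the most recent variable `x`. -/
def Comp.inst {Γ : Ctx Op Base} {A B : VTy Op Base} {𝒯 : EffTheory Op Base}
    (M : Comp (A :: Γ) B 𝒯) (V : Val Γ A) : Comp Γ B 𝒯 :=
  M.subst ((Sub.id Γ).cons V)

/-- `M[V/x, W/k]` for the two most recent variables `x`, `k` (with `k` the most recent). -/
def Comp.inst₂ {Γ : Ctx Op Base} {A A' B : VTy Op Base} {𝒯 : EffTheory Op Base}
    (M : Comp (A' :: A :: Γ) B 𝒯) (V : Val Γ A) (W : Val Γ A') : Comp Γ B 𝒯 :=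
  M.subst (((Sub.id Γ).cons V).cons W)

/-! ### Instantiating effect theory terms in the calculus -/

/-- Substitutions of value terms of the calculus for the variables of a ground context. -/
abbrev GSub (Δ : List (GTy Base)) (Γ : Ctx Op Base) : Type (max u₁ u₂) :=
  ∀ A : GTy Base, Var Δ A → Val Γ (A.toVTy Op)

/-- Extension of a substitution by a term for one more variable. -/
def GSub.cons {Δ : List (GTy Base)} {Γ : Ctx Op Base} (σ : GSub Δ Γ) {B : GTy Base}
    (W : Val Γ (B.toVTy Op)) : GSub (B :: Δ) Γ
  | _, .here => W
  | _, .there x => σ _ x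

/-- Weakening of a substitution. -/
def GSub.wk {Δ : List (GTy Base)} {Γ : Ctx Op Base} (σ : GSub Δ Γ) (B : VTy Op Base) :
    GSub Δ (B :: Γ) :=
  fun _ x => (σ _ x).ren (Ren.wk Γ B)

/-- Extension of a substitution under a binder. -/
def GSub.lift {Δ : List (GTy Base)} {Γ : Ctx Op Base} (σ : GSub Δ Γ) (B : GTy Base) :
    GSub (B :: Δ) (B.toVTy Op :: Γ) :=
  GSub.cons (σ.wk (B.toVTy Op)) (.var .here)

/-- `V[σ]` for a ground term `V`. -/
def GTm.inst {Δ : List (GTy Base)} {Γ : Ctx Op Base} (σ : GSub Δ Γ) :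
    {A : GTy Base} → GTm Δ A → Val Γ (A.toVTy Op)
  | _, .var x => σ _ x
  | _, .tuple V => .tuple fun i => (V i).inst σ
  | _, .proj (A := A) i V => .proj (A := fun i => (A i).toVTy Op) i (V.inst σ)
  | _, .inj (A := A) i V => .inj (A := fun i => (A i).toVTy Op) i (V.inst σ)

/-- `M[σ]` for an effect theory term `M` of the signature of `𝒯`. -/
def ETm.inst {𝒯 : EffTheory Op Base} : {Δ : List (GTy Base)} → {A : GTy Base} →
    ETm 𝒯.sig Δ A → {Γ : Ctx Op Base} → GSub Δ Γ → Comp Γ (A.toVTy Op) 𝒯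
  | _, _, .ret V, _, σ => .ret (V.inst σ)
  | _, _, .letOp o V M, _, σ => .letIn (.op o (V.inst σ)) (M.inst (σ.lift _))
  | _, _, .case (A := A) V M, _, σ =>
      .case (A := fun i => (A i).toVTy Op) (V.inst σ) fun i => (M i).inst (σ.lift _)

/-- The translation of an effect theory term along a handler `H` and a continuation `k`, with the
variables of the ground context replaced according to `σ`. -/
def ETm.trans {S : Sig Op Base} {B : VTy Op Base} {𝒯' : EffTheory Op Base} :
    {Δ : List (GTy Base)} → {A : GTy Base} → ETm S Δ A → {Γ : Ctx Op Base} → GSub Δ Γ →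
    Hdl Γ S B 𝒯' → Val Γ (.fn (A.toVTy Op) B 𝒯') → Comp Γ B 𝒯'
  | _, _, .ret V, _, σ, _, k => .app k (V.inst σ)
  | _, _, .letOp o V N, Γ, σ, H, k =>
      (H o).inst₂ (V.inst σ)
        (.lam (N.trans (σ.lift _) (Hdl.ren H (Ren.wk Γ _)) (k.ren (Ren.wk Γ _))))
  | _, _, .case (A := A) V M, Γ, σ, H, k =>
      .case (A := fun i => (A i).toVTy Op) (V.inst σ) fun i =>
        (M i).trans (σ.lift _) (Hdl.ren H (Ren.wk Γ _)) (k.ren (Ren.wk Γ _))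

/-- Ground contexts are contexts. -/
def gctx (Op : Type u₁) (Δ : List (GTy Base)) : Ctx Op Base := Δ.map (GTy.toVTy Op)

/-- The variables of the ground context `Δ` in the context `Γ, Δ`. -/
def gvar (Γ : Ctx Op Base) : {Δ : List (GTy Base)} → {A : GTy Base} → Var Δ A →
    Var (gctx Op Δ ++ Γ) (A.toVTy Op)
  | _ :: _, _, .here => .here
  | _ :: _, _, .there x => .there (gvar Γ x)

/-- The weakening renaming from `Γ` to `Γ, Δ`. -/
def gwk (Γ : Ctx Op Base) : (Δ : List (GTy Base)) → Ren Γ (gctx Op Δ ++ Γ)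
  | [], _, x => x
  | _ :: Δ, A, x => .there (gwk Γ Δ A x)

/-- `M[H, k]`, a term in the context `Γ, Δ, k : A → B ! Σ'/ℰ'`. -/
def ETm.transK {Γ : Ctx Op Base} {S : Sig Op Base} {B : VTy Op Base} {𝒯' : EffTheory Op Base}
    {Δ : List (GTy Base)} {A : GTy Base} (M : ETm S Δ A) (H : Hdl Γ S B 𝒯') :
    Comp (.fn (A.toVTy Op) B 𝒯' :: (gctx Op Δ ++ Γ)) B 𝒯' :=
  M.trans (fun _ x => .var (.there (gvar Γ x)))
    (Hdl.ren H fun _ x => .there (gwk Γ Δ _ x)) (.var .here)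

/-! ## Typing and equational theory

The typing judgements of the calculus (for simply typed terms, these say that all handlers that
are used respect the axioms) and the equality judgements, by simultaneous induction. -/

mutual

/-- `Γ ⊢ V : A`. -/
inductive WTVal : {Γ : Ctx Op Base} → {A : VTy Op Base} → Val Γ A → Prop
  | var {Γ : Ctx Op Base} {A : VTy Op Base} (x : Var Γ A) : WTVal (.var x)
  | lam {Γ : Ctx Op Base} {A B : VTy Op Base} {𝒯 : EffTheory Op Base}
      {M : Comp (A :: Γ) B 𝒯} : WTComp M → WTVal (.lam M)
  | tuple {Γ : Ctx Op Base} {n : ℕ} {A : Fin n → VTy Op Base} {V : ∀ i, Val Γ (A i)} :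
      (∀ i, WTVal (V i)) → WTVal (.tuple V)
  | proj {Γ : Ctx Op Base} {n : ℕ} {A : Fin n → VTy Op Base} (i : Fin n)
      {V : Val Γ (.prod n A)} : WTVal V → WTVal (.proj i V)
  | inj {Γ : Ctx Op Base} {n : ℕ} {A : Fin n → VTy Op Base} (i : Fin n) {V : Val Γ (A i)} :
      WTVal V → WTVal (.inj (A := A) i V)

/-- `Γ ⊢ M : A ! Σ/ℰ`. -/
inductive WTComp : {Γ : Ctx Op Base} → {A : VTy Op Base} → {𝒯 : EffTheory Op Base} →
    Comp Γ A 𝒯 → Prop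
  | app {Γ : Ctx Op Base} {A B : VTy Op Base} {𝒯 : EffTheory Op Base}
      {V : Val Γ (.fn A B 𝒯)} {W : Val Γ A} : WTVal V → WTVal W → WTComp (.app V W)
  | ret {Γ : Ctx Op Base} {A : VTy Op Base} {𝒯 : EffTheory Op Base} {V : Val Γ A} :
      WTVal V → WTComp (.ret (𝒯 := 𝒯) V)
  | letIn {Γ : Ctx Op Base} {A B : VTy Op Base} {𝒯 : EffTheory Op Base}
      {M : Comp Γ A 𝒯} {N : Comp (A :: Γ) B 𝒯} : WTComp M → WTComp N → WTComp (.letIn M N)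
  | op {Γ : Ctx Op Base} {𝒯 : EffTheory Op Base} (o : 𝒯.sig.Ops)
      {V : Val Γ ((𝒯.sig.arg o).toVTy Op)} : WTVal V → WTComp (.op o V)
  | case {Γ : Ctx Op Base} {n : ℕ} {A : Fin n → VTy Op Base} {B : VTy Op Base}
      {𝒯 : EffTheory Op Base} {V : Val Γ (.sum n A)} {M : ∀ i, Comp (A i :: Γ) B 𝒯} :
      WTVal V → (∀ i, WTComp (M i)) → WTComp (.case V M)
  | handle {Γ : Ctx Op Base} {A B : VTy Op Base} {𝒯 𝒯' : EffTheory Op Base}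
      {M : Comp Γ A 𝒯} {H : Hdl Γ 𝒯.sig B 𝒯'} {N : Comp (A :: Γ) B 𝒯'} :
      WTComp M → Respects 𝒯 H → WTComp N → WTComp (.handle M H N)

/-- `Γ ⊢ H : S ⇒ B ! Σ'/ℰ'`. -/
inductive WTHdl : {Γ : Ctx Op Base} → {S : Sig Op Base} → {B : VTy Op Base} →
    {𝒯' : EffTheory Op Base} → Hdl Γ S B 𝒯' → Prop
  | mk {Γ : Ctx Op Base} {S : Sig Op Base} {B : VTy Op Base} {𝒯' : EffTheory Op Base}
      {H : Hdl Γ S B 𝒯'} : (∀ o, WTComp (H o)) → WTHdl H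

/-- `Γ ⊢ H : Σ ⇒ B ! Σ'/ℰ' respects ℰ`, for the effect theory `𝒯 = (Σ, ℰ)`. -/
inductive Respects : {Γ : Ctx Op Base} → (𝒯 : EffTheory Op Base) → {B : VTy Op Base} →
    {𝒯' : EffTheory Op Base} → Hdl Γ 𝒯.sig B 𝒯' → Prop
  | mk {Γ : Ctx Op Base} {𝒯 : EffTheory Op Base} {B : VTy Op Base} {𝒯' : EffTheory Op Base}
      {H : Hdl Γ 𝒯.sig B 𝒯'} : WTHdl H →
      (∀ a ∈ 𝒯.ax, EqComp (a.lhs.transK H) (a.rhs.transK H)) → Respects 𝒯 H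

/-- `Γ ⊢ V = W : A`. -/
inductive EqVal : {Γ : Ctx Op Base} → {A : VTy Op Base} → Val Γ A → Val Γ A → Prop
  | refl {Γ : Ctx Op Base} {A : VTy Op Base} {V : Val Γ A} : WTVal V → EqVal V V
  | symm {Γ : Ctx Op Base} {A : VTy Op Base} {V W : Val Γ A} : EqVal V W → EqVal W V
  | trans {Γ : Ctx Op Base} {A : VTy Op Base} {U V W : Val Γ A} :
      EqVal U V → EqVal V W → EqVal U W
  | lam {Γ : Ctx Op Base} {A B : VTy Op Base} {𝒯 : EffTheory Op Base}
      {M N : Comp (A :: Γ) B 𝒯} : EqComp M N → EqVal (.lam M) (.lam N)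
  | tuple {Γ : Ctx Op Base} {n : ℕ} {A : Fin n → VTy Op Base} {V W : ∀ i, Val Γ (A i)} :
      (∀ i, EqVal (V i) (W i)) → EqVal (.tuple V) (.tuple W)
  | proj {Γ : Ctx Op Base} {n : ℕ} {A : Fin n → VTy Op Base} (i : Fin n)
      {V W : Val Γ (.prod n A)} : EqVal V W → EqVal (.proj i V) (.proj i W)
  | inj {Γ : Ctx Op Base} {n : ℕ} {A : Fin n → VTy Op Base} (i : Fin n) {V W : Val Γ (A i)} :
      EqVal V W → EqVal (.inj (A := A) i V) (.inj (A := A) i W)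
  | lam_eta {Γ : Ctx Op Base} {A B : VTy Op Base} {𝒯 : EffTheory Op Base}
      {V : Val Γ (.fn A B 𝒯)} : WTVal V →
      EqVal V (.lam (.app (V.ren (Ren.wk Γ A)) (.var .here)))
  | prod_beta {Γ : Ctx Op Base} {n : ℕ} {A : Fin n → VTy Op Base} {V : ∀ i, Val Γ (A i)}
      (i : Fin n) : (∀ j, WTVal (V j)) → EqVal (.proj i (.tuple V)) (V i)
  | prod_eta {Γ : Ctx Op Base} {n : ℕ} {A : Fin n → VTy Op Base} {V : Val Γ (.prod n A)} :
      WTVal V → EqVal V (.tuple fun i => .proj i V)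

/-- `Γ ⊢ M = N : A ! Σ/ℰ`. -/
inductive EqComp : {Γ : Ctx Op Base} → {A : VTy Op Base} → {𝒯 : EffTheory Op Base} →
    Comp Γ A 𝒯 → Comp Γ A 𝒯 → Prop
  | refl {Γ : Ctx Op Base} {A : VTy Op Base} {𝒯 : EffTheory Op Base} {M : Comp Γ A 𝒯} :
      WTComp M → EqComp M M
  | symm {Γ : Ctx Op Base} {A : VTy Op Base} {𝒯 : EffTheory Op Base} {M N : Comp Γ A 𝒯} :
      EqComp M N → EqComp N M
  | trans {Γ : Ctx Op Base} {A : VTy Op Base} {𝒯 : EffTheory Op Base} {L M N : Comp Γ A 𝒯} :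
      EqComp L M → EqComp M N → EqComp L N
  | app {Γ : Ctx Op Base} {A B : VTy Op Base} {𝒯 : EffTheory Op Base}
      {V V' : Val Γ (.fn A B 𝒯)} {W W' : Val Γ A} :
      EqVal V V' → EqVal W W' → EqComp (.app V W) (.app V' W')
  | ret {Γ : Ctx Op Base} {A : VTy Op Base} {𝒯 : EffTheory Op Base} {V W : Val Γ A} :
      EqVal V W → EqComp (.ret (𝒯 := 𝒯) V) (.ret (𝒯 := 𝒯) W)
  | letIn {Γ : Ctx Op Base} {A B : VTy Op Base} {𝒯 : EffTheory Op Base}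
      {M M' : Comp Γ A 𝒯} {N N' : Comp (A :: Γ) B 𝒯} :
      EqComp M M' → EqComp N N' → EqComp (.letIn M N) (.letIn M' N')
  | op {Γ : Ctx Op Base} {𝒯 : EffTheory Op Base} (o : 𝒯.sig.Ops)
      {V W : Val Γ ((𝒯.sig.arg o).toVTy Op)} : EqVal V W → EqComp (.op o V) (.op o W)
  | case {Γ : Ctx Op Base} {n : ℕ} {A : Fin n → VTy Op Base} {B : VTy Op Base}
      {𝒯 : EffTheory Op Base} {V V' : Val Γ (.sum n A)} {M M' : ∀ i, Comp (A i :: Γ) B 𝒯} :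
      EqVal V V' → (∀ i, EqComp (M i) (M' i)) → EqComp (.case V M) (.case V' M')
  | handle {Γ : Ctx Op Base} {A B : VTy Op Base} {𝒯 𝒯' : EffTheory Op Base}
      {M M' : Comp Γ A 𝒯} {H H' : Hdl Γ 𝒯.sig B 𝒯'} {N N' : Comp (A :: Γ) B 𝒯'} :
      EqComp M M' → EqHdl H H' → Respects 𝒯 H → EqComp N N' →
      EqComp (.handle M H N) (.handle M' H' N')
  | lam_beta {Γ : Ctx Op Base} {A B : VTy Op Base} {𝒯 : EffTheory Op Base}
      {M : Comp (A :: Γ) B 𝒯} {V : Val Γ A} : WTComp M → WTVal V →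
      EqComp (.app (.lam M) V) (M.inst V)
  | sum_beta {Γ : Ctx Op Base} {n : ℕ} {A : Fin n → VTy Op Base} {B : VTy Op Base}
      {𝒯 : EffTheory Op Base} (i : Fin n) {V : Val Γ (A i)} {M : ∀ i, Comp (A i :: Γ) B 𝒯} :
      WTVal V → (∀ j, WTComp (M j)) → EqComp (.case (.inj i V) M) ((M i).inst V)
  | sum_eta {Γ : Ctx Op Base} {n : ℕ} {A : Fin n → VTy Op Base} {B : VTy Op Base}
      {𝒯 : EffTheory Op Base} {V : Val Γ (.sum n A)} {M : Comp (.sum n A :: Γ) B 𝒯} :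
      WTVal V → WTComp M →
      EqComp
        (.case V fun i =>
          M.subst (Sub.cons (fun _ x => .var (.there x)) (.inj (A := A) i (.var .here))))
        (M.inst V)
  | let_beta {Γ : Ctx Op Base} {A B : VTy Op Base} {𝒯 : EffTheory Op Base}
      {V : Val Γ A} {M : Comp (A :: Γ) B 𝒯} : WTVal V → WTComp M →
      EqComp (.letIn (.ret V) M) (M.inst V)
  | let_eta {Γ : Ctx Op Base} {A : VTy Op Base} {𝒯 : EffTheory Op Base} {M : Comp Γ A 𝒯} :
      WTComp M → EqComp (.letIn M (.ret (.var .here))) M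
  | let_assoc {Γ : Ctx Op Base} {A₁ A₂ A₃ : VTy Op Base} {𝒯 : EffTheory Op Base}
      {M : Comp Γ A₁ 𝒯} {N : Comp (A₁ :: Γ) A₂ 𝒯} {L : Comp (A₂ :: Γ) A₃ 𝒯} :
      WTComp M → WTComp N → WTComp L →
      EqComp (.letIn (.letIn M N) L) (.letIn M (.letIn N (L.ren ((Ren.wk Γ A₁).lift A₂))))
  | handle_ret {Γ : Ctx Op Base} {A B : VTy Op Base} {𝒯 𝒯' : EffTheory Op Base}
      {V : Val Γ A} {H : Hdl Γ 𝒯.sig B 𝒯'} {M : Comp (A :: Γ) B 𝒯'} :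
      WTVal V → WTComp M → Respects 𝒯 H →
      EqComp (.handle (.ret V) H M) (M.inst V)
  | handle_let {Γ : Ctx Op Base} {A A' B : VTy Op Base} {𝒯 𝒯' : EffTheory Op Base}
      {L : Comp Γ A 𝒯} {M : Comp (A :: Γ) A' 𝒯} {H : Hdl Γ 𝒯.sig B 𝒯'}
      {N : Comp (A' :: Γ) B 𝒯'} :
      Respects 𝒯 H → WTComp L → WTComp M → WTComp N →
      EqComp (.handle (.letIn L M) H N)
        (.handle L H
          (.handle M (Hdl.ren H (Ren.wk Γ A)) (N.ren ((Ren.wk Γ A).lift A'))))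
  | handle_op {Γ : Ctx Op Base} {B : VTy Op Base} {𝒯 𝒯' : EffTheory Op Base}
      (o : 𝒯.sig.Ops) {V : Val Γ ((𝒯.sig.arg o).toVTy Op)} {H : Hdl Γ 𝒯.sig B 𝒯'}
      {M : Comp ((𝒯.sig.res o).toVTy Op :: Γ) B 𝒯'} :
      Respects 𝒯 H → WTComp M → WTVal V →
      EqComp (.handle (.op o V) H M) ((H o).inst₂ V (.lam M))
  | inst_ax {Γ : Ctx Op Base} {𝒯 : EffTheory Op Base} (a : Axm 𝒯.sig) (σ : GSub a.ctx Γ) :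
      a ∈ 𝒯.ax → (∀ (A : GTy Base) (x : Var a.ctx A), WTVal (σ A x)) →
      EqComp (a.lhs.inst σ) (a.rhs.inst σ)

/-- `Γ ⊢ H = H' : S ⇒ B ! Σ'/ℰ'`. -/
inductive EqHdl : {Γ : Ctx Op Base} → {S : Sig Op Base} → {B : VTy Op Base} →
    {𝒯' : EffTheory Op Base} → Hdl Γ S B 𝒯' → Hdl Γ S B 𝒯' → Prop
  | refl {Γ : Ctx Op Base} {S : Sig Op Base} {B : VTy Op Base} {𝒯' : EffTheory Op Base}
      {H : Hdl Γ S B 𝒯'} : WTHdl H → EqHdl H H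
  | symm {Γ : Ctx Op Base} {S : Sig Op Base} {B : VTy Op Base} {𝒯' : EffTheory Op Base}
      {H H' : Hdl Γ S B 𝒯'} : EqHdl H H' → EqHdl H' H
  | trans {Γ : Ctx Op Base} {S : Sig Op Base} {B : VTy Op Base} {𝒯' : EffTheory Op Base}
      {H H' H'' : Hdl Γ S B 𝒯'} : EqHdl H H' → EqHdl H' H'' → EqHdl H H''
  | congr {Γ : Ctx Op Base} {S : Sig Op Base} {B : VTy Op Base} {𝒯' : EffTheory Op Base}
      {H H' : Hdl Γ S B 𝒯'} : (∀ o, EqComp (H o) (H' o)) → EqHdl H H'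

end

end Terms

/-! ## Models -/

/-- A strong monad on a cartesian category. -/
structure StrongMonad (C : Type u) [Category.{v} C] [CartesianMonoidalCategory C]
    extends Monad C where
  str (X Y : C) : X ⊗ obj Y ⟶ obj (X ⊗ Y)
  str_natural {X X' Y Y' : C} (f : X ⟶ X') (g : Y ⟶ Y') :
    (f ⊗ₘ map g) ≫ str X' Y' = str X Y ≫ map (f ⊗ₘ g)
  str_leftUnitor (Y : C) : str (𝟙_ C) Y ≫ map (λ_ Y).hom = (λ_ (obj Y)).hom
  str_associator (X Y Z : C) :
    str (X ⊗ Y) Z ≫ map (α_ X Y Z).hom =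
      (α_ X Y (obj Z)).hom ≫ (X ◁ str Y Z) ≫ str X (Y ⊗ Z)
  str_unit (X Y : C) : (X ◁ η.app Y) ≫ str X Y = η.app (X ⊗ Y)
  str_mult (X Y : C) :
    (X ◁ μ.app Y) ≫ str X Y = str X (obj Y) ≫ map (str X Y) ≫ μ.app (X ⊗ Y)

/-- `ι` is a Kleisli coproduct diagram: its image in the Kleisli category is a coproduct. -/
def IsKleisliCoproduct {C : Type u} [Category.{v} C] [CartesianMonoidalCategory C]
    (T : StrongMonad C) {n : ℕ} (X : Fin n → C) {P : C} (ι : ∀ i, X i ⟶ P) : Prop :=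
  ∀ (Y : C) (f : ∀ i, X i ⟶ T.obj Y), ∃! g : P ⟶ T.obj Y, ∀ i, ι i ≫ g = f i

/-- `ι` is a distributive Kleisli coproduct diagram. -/
structure IsDistribKleisliCoproduct {C : Type u} [Category.{v} C] [CartesianMonoidalCategory C]
    (T : StrongMonad C) {n : ℕ} (X : Fin n → C) {P : C} (ι : ∀ i, X i ⟶ P) : Prop where
  isKleisliCoproduct : IsKleisliCoproduct T X ι
  distrib (Z : C) : IsKleisliCoproduct T (fun i => Z ⊗ X i) (fun i => Z ◁ ι i)

/-- The part of a model that interprets types and ground terms: a family of strong monads indexed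
by effect theories on a cartesian category, with Kleisli exponentials `kexp 𝒯 Y Z` (with
`Λ = curry`), joint distributive Kleisli coproducts, and objects interpreting the base types. -/
structure PreModel (Op : Type u₁) (Base : Type u₂) (C : Type u) [Category.{v} C]
    [CartesianMonoidalCategory C] where
  T : EffTheory Op Base → StrongMonad C
  kexp : EffTheory Op Base → C → C → C
  curry (𝒯 : EffTheory Op Base) (X Y Z : C) : (X ⊗ Y ⟶ (T 𝒯).obj Z) ≃ (X ⟶ kexp 𝒯 Y Z)
  curry_natural (𝒯 : EffTheory Op Base) {X X' Y Z : C} (g : X' ⟶ X)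
    (f : X ⊗ Y ⟶ (T 𝒯).obj Z) :
    curry 𝒯 X' Y Z ((g ▷ Y) ≫ f) = g ≫ curry 𝒯 X Y Z f
  sum {n : ℕ} (X : Fin n → C) : C
  inj {n : ℕ} (X : Fin n → C) (i : Fin n) : X i ⟶ sum X
  isCoproduct (𝒯 : EffTheory Op Base) {n : ℕ} (X : Fin n → C) :
    IsDistribKleisliCoproduct (T 𝒯) X (inj X)
  base : Base → C

noncomputable section

namespace PreModel

variable {Op : Type u₁} {Base : Type u₂} {C : Type u} [Category.{v} C]
  [CartesianMonoidalCategory C]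

/-- The evaluation morphism of a Kleisli exponential. -/
def eval (P : PreModel Op Base C) (𝒯 : EffTheory Op Base) (Y Z : C) :
    P.kexp 𝒯 Y Z ⊗ Y ⟶ (P.T 𝒯).obj Z :=
  (P.curry 𝒯 _ Y Z).symm (𝟙 _)

/-- The cotupling `[f₁, …, fₙ] : Z × (X₁ + ⋯ + Xₙ) ⟶ T Y` of `fᵢ : Z × Xᵢ ⟶ T Y`. -/
def cotuple (P : PreModel Op Base C) (𝒯 : EffTheory Op Base) {n : ℕ} {X : Fin n → C} {Z Y : C}
    (f : ∀ i, Z ⊗ X i ⟶ (P.T 𝒯).obj Y) : Z ⊗ P.sum X ⟶ (P.T 𝒯).obj Y :=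
  ((P.isCoproduct 𝒯 X).distrib Z Y f).choose

/-- Interpretation of value types. -/
def ty (P : PreModel Op Base C) : VTy Op Base → C
  | .base b => P.base b
  | .fn A B 𝒯 => P.kexp 𝒯 (P.ty A) (P.ty B)
  | .prod _ A => ∏ᶜ fun i => P.ty (A i)
  | .sum _ A => P.sum fun i => P.ty (A i)

/-- Interpretation of ground types. -/
abbrev gty (P : PreModel Op Base C) (A : GTy Base) : C := P.ty (A.toVTy Op)

/-- Interpretation of contexts. -/
def ctx (P : PreModel Op Base C) : Ctx Op Base → C
  | [] => 𝟙_ C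
  | A :: Γ => P.ctx Γ ⊗ P.ty A

/-- Interpretation of ground contexts. -/
def gctx (P : PreModel Op Base C) : List (GTy Base) → C
  | [] => 𝟙_ C
  | A :: Δ => P.gctx Δ ⊗ P.gty A

/-- Interpretation of variables. -/
def var (P : PreModel Op Base C) :
    {Γ : Ctx Op Base} → {A : VTy Op Base} → Var Γ A → (P.ctx Γ ⟶ P.ty A)
  | _ :: _, _, .here => snd _ _
  | _ :: _, _, .there x => fst _ _ ≫ P.var x

/-- Interpretation of variables of ground contexts. -/
def gvar (P : PreModel Op Base C) :
    {Δ : List (GTy Base)} → {A : GTy Base} → Var Δ A → (P.gctx Δ ⟶ P.gty A)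
  | _ :: _, _, .here => snd _ _
  | _ :: _, _, .there x => fst _ _ ≫ P.gvar x

/-- Interpretation of ground terms. -/
def gtm (P : PreModel Op Base C) {Δ : List (GTy Base)} :
    {A : GTy Base} → GTm Δ A → (P.gctx Δ ⟶ P.gty A)
  | _, .var x => P.gvar x
  | _, .tuple (A := A) V => Pi.lift (f := fun i => P.gty (A i)) fun i => P.gtm (V i)
  | _, .proj (A := A) i V => P.gtm V ≫ Pi.π (fun i => P.gty (A i)) i
  | _, .inj (A := A) i V => P.gtm V ≫ P.inj (fun i => P.gty (A i)) i

/-- Interpretation of effect theory terms, for a given interpretation of the operations of the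
signature in a monad. -/
def etm (P : PreModel Op Base C) (𝒯 : EffTheory Op Base) {S : Sig Op Base}
    (op : ∀ o : S.Ops, P.gty (S.arg o) ⟶ (P.T 𝒯).obj (P.gty (S.res o))) :
    {Δ : List (GTy Base)} → {A : GTy Base} → ETm S Δ A → (P.gctx Δ ⟶ (P.T 𝒯).obj (P.gty A))
  | _, _, .ret V => P.gtm V ≫ (P.T 𝒯).η.app _
  | _, _, .letOp o V M =>
      lift (𝟙 _) (P.gtm V ≫ op o) ≫ (P.T 𝒯).str _ _ ≫ (P.T 𝒯).map (P.etm 𝒯 op M) ≫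
        (P.T 𝒯).μ.app _
  | _, _, .case V M => lift (𝟙 _) (P.gtm V) ≫ P.cotuple 𝒯 fun i => P.etm 𝒯 op (M i)

/-- An interpretation of the operations satisfies the equational axioms `E`. -/
def OpSat (P : PreModel Op Base C) (𝒯 : EffTheory Op Base) {S : Sig Op Base}
    (op : ∀ o : S.Ops, P.gty (S.arg o) ⟶ (P.T 𝒯).obj (P.gty (S.res o))) (E : Set (Axm S)) :
    Prop :=
  ∀ a ∈ E, P.etm 𝒯 op a.lhs = P.etm 𝒯 op a.rhs

/-- The factor of `hdl` for one operation. -/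
abbrev clause (P : PreModel Op Base C) (S : Sig Op Base) (𝒯 : EffTheory Op Base) (X : C)
    (o : S.Ops) : C :=
  P.kexp 𝒯 (P.gty (S.arg o) ⊗ P.kexp 𝒯 (P.gty (S.res o)) X) X

/-- The object of `S`-algebra structures on `X` in the Kleisli category of `T 𝒯`. -/
abbrev hdl (P : PreModel Op Base C) (S : Sig Op Base) (𝒯 : EffTheory Op Base) (X : C) : C :=
  ∏ᶜ P.clause S 𝒯 X

/-- The rearrangement `(Y × (D × K)) × B ⟶ Y × ((D × B) × K)`. -/
def rearrange (Y D K B : C) : (Y ⊗ (D ⊗ K)) ⊗ B ⟶ Y ⊗ ((D ⊗ B) ⊗ K) :=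
  lift (fst _ _ ≫ fst _ _)
    (lift (lift (fst _ _ ≫ snd _ _ ≫ fst _ _) (snd _ _)) (fst _ _ ≫ snd _ _ ≫ snd _ _))

/-- The uncurried form of `alg`. -/
def algUncurried (P : PreModel Op Base C) {S : Sig Op Base} (𝒯 : EffTheory Op Base) (X : C) :
    {Δ : List (GTy Base)} → {A : GTy Base} → ETm S Δ A →
    (P.hdl S 𝒯 X ⊗ (P.gctx Δ ⊗ P.kexp 𝒯 (P.gty A) X) ⟶ (P.T 𝒯).obj X)
  | _, _, .ret V => snd _ _ ≫ lift (snd _ _) (fst _ _ ≫ P.gtm V) ≫ P.eval 𝒯 _ X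
  | _, _, .letOp o V M =>
      lift (fst _ _ ≫ Pi.π (P.clause S 𝒯 X) o)
        (lift (snd _ _ ≫ fst _ _ ≫ P.gtm V)
          (P.curry 𝒯 _ _ X (rearrange _ _ _ _ ≫ P.algUncurried 𝒯 X M))) ≫ P.eval 𝒯 _ X
  | _, _, .case V M =>
      lift (𝟙 _) (snd _ _ ≫ fst _ _ ≫ P.gtm V) ≫
        P.cotuple 𝒯 fun i => rearrange _ _ _ _ ≫ P.algUncurried 𝒯 X (M i)

/-- The interpretation of an effect theory term as an operation on `S`-algebra structures. -/
def alg (P : PreModel Op Base C) {S : Sig Op Base} (𝒯 : EffTheory Op Base) (X : C)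
    {Δ : List (GTy Base)} {A : GTy Base} (M : ETm S Δ A) :
    P.hdl S 𝒯 X ⟶ P.kexp 𝒯 (P.gctx Δ ⊗ P.kexp 𝒯 (P.gty A) X) X :=
  P.curry 𝒯 _ _ X (P.algUncurried 𝒯 X M)

/-- A generalized element of `hdl` satisfies the equational axioms `E`. -/
def AlgSat (P : PreModel Op Base C) {S : Sig Op Base} (E : Set (Axm S)) (𝒯 : EffTheory Op Base)
    (X : C) {Z : C} (h : Z ⟶ P.hdl S 𝒯 X) : Prop :=
  ∀ a ∈ E, h ≫ P.alg 𝒯 X a.lhs = h ≫ P.alg 𝒯 X a.rhs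

theorem AlgSat.comp {P : PreModel Op Base C} {S : Sig Op Base} {E : Set (Axm S)}
    {𝒯 : EffTheory Op Base} {X : C} {Z Z' : C} {h : Z ⟶ P.hdl S 𝒯 X} (hh : P.AlgSat E 𝒯 X h)
    (g : Z' ⟶ Z) : P.AlgSat E 𝒯 X (g ≫ h) := fun a ha => by
  rw [Category.assoc, Category.assoc, hh a ha]

/-- The presheaf of generalized elements of `hdl` that satisfy the axioms of `𝒯`. -/
abbrev HSat (P : PreModel Op Base C) (𝒯 𝒯' : EffTheory Op Base) (X Z : C) : Type v :=
  {h : Z ⟶ P.hdl 𝒯.sig 𝒯' X // P.AlgSat 𝒯.ax 𝒯' X h}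

/-- Restriction maps of the presheaf `HSat`. -/
def HSat.comp {P : PreModel Op Base C} {𝒯 𝒯' : EffTheory Op Base} {X Z Z' : C} (g : Z' ⟶ Z)
    (h : P.HSat 𝒯 𝒯' X Z) : P.HSat 𝒯 𝒯' X Z' :=
  ⟨g ≫ h.1, h.2.comp g⟩

/-- The morphism `A × (B ⇒ X) ⟶ T T' X` induced by a generic effect `A ⟶ T B`. -/
def mixedAlgOp (P : PreModel Op Base C) (𝒯 𝒯' : EffTheory Op Base) (X : C) {A B : C}
    (f : A ⟶ (P.T 𝒯).obj B) :
    A ⊗ P.kexp 𝒯' B X ⟶ (P.T 𝒯).obj ((P.T 𝒯').obj X) :=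
  lift (snd _ _) (fst _ _ ≫ f) ≫ (P.T 𝒯).str _ _ ≫ (P.T 𝒯).map (P.eval 𝒯' B X)

end PreModel

/-- Models of the calculus. -/
structure Model (Op : Type u₁) (Base : Type u₂) (C : Type u) [Category.{v} C]
    [CartesianMonoidalCategory C] extends PreModel Op Base C where
  op (𝒯 : EffTheory Op Base) (o : 𝒯.sig.Ops) :
    toPreModel.gty (𝒯.sig.arg o) ⟶ (T 𝒯).obj (toPreModel.gty (𝒯.sig.res o))
  op_sat (𝒯 : EffTheory Op Base) : toPreModel.OpSat 𝒯 (op 𝒯) 𝒯.ax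
  handle (𝒯 𝒯' : EffTheory Op Base) (X : C) {Z : C} (h : toPreModel.HSat 𝒯 𝒯' X Z)
    (f : Z ⟶ (T 𝒯).obj ((T 𝒯').obj X)) : Z ⟶ (T 𝒯').obj X
  handle_natural (𝒯 𝒯' : EffTheory Op Base) (X : C) {Z Z' : C} (g : Z' ⟶ Z)
    (h : toPreModel.HSat 𝒯 𝒯' X Z) (f : Z ⟶ (T 𝒯).obj ((T 𝒯').obj X)) :
    g ≫ handle 𝒯 𝒯' X h f = handle 𝒯 𝒯' X (h.comp g) (g ≫ f)
  handle_unit (𝒯 𝒯' : EffTheory Op Base) (X : C) {Z : C} (h : toPreModel.HSat 𝒯 𝒯' X Z)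
    (f : Z ⟶ (T 𝒯').obj X) : handle 𝒯 𝒯' X h (f ≫ (T 𝒯).η.app _) = f
  handle_mult (𝒯 𝒯' : EffTheory Op Base) (X : C) {Z : C} (h : toPreModel.HSat 𝒯 𝒯' X Z)
    (f : Z ⟶ (T 𝒯).obj ((T 𝒯).obj ((T 𝒯').obj X))) :
    handle 𝒯 𝒯' X h (f ≫ (T 𝒯).μ.app _) =
      handle 𝒯 𝒯' X h
        (lift (𝟙 Z) f ≫ (T 𝒯).str _ _ ≫
          (T 𝒯).map (handle 𝒯 𝒯' X (h.comp (fst Z ((T 𝒯).obj ((T 𝒯').obj X)))) (snd _ _)))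
  handle_op (𝒯 𝒯' : EffTheory Op Base) (X : C) {Z : C} (h : toPreModel.HSat 𝒯 𝒯' X Z)
    (o : 𝒯.sig.Ops)
    (f : Z ⟶ toPreModel.gty (𝒯.sig.arg o) ⊗ kexp 𝒯' (toPreModel.gty (𝒯.sig.res o)) X) :
    handle 𝒯 𝒯' X h (f ≫ toPreModel.mixedAlgOp 𝒯 𝒯' X (op 𝒯 o)) =
      lift (h.1 ≫ Pi.π (toPreModel.clause 𝒯.sig 𝒯' X) o) f ≫ toPreModel.eval 𝒯' _ X

/-! ## The partial interpretation -/

/-- A family of partial values is defined if all its members are defined. -/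
def partPi {ι : Type w} {α : ι → Type v} (p : ∀ i, Part (α i)) : Part (∀ i, α i) :=
  ⟨∀ i, (p i).Dom, fun h i => (p i).get (h i)⟩

namespace Model

variable {Op : Type u₁} {Base : Type u₂} {C : Type u} [Category.{v} C]
  [CartesianMonoidalCategory C]

/-- The interpretation of a handler from the interpretations of its clauses. -/
def hdlOfClauses (𝓜 : Model Op Base C) {Γ : Ctx Op Base} {S : Sig Op Base} {B : VTy Op Base}
    {𝒯' : EffTheory Op Base}
    (m : ∀ o : S.Ops,
      𝓜.ctx (.fn ((S.res o).toVTy Op) B 𝒯' :: (S.arg o).toVTy Op :: Γ) ⟶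
        (𝓜.T 𝒯').obj (𝓜.ty B)) :
    𝓜.ctx Γ ⟶ 𝓜.hdl S 𝒯' (𝓜.ty B) :=
  Pi.lift fun o => 𝓜.curry 𝒯' _ _ _ ((α_ _ _ _).inv ≫ m o)

mutual

/-- Partial interpretation of value terms. -/
def val (𝓜 : Model Op Base C) :
    {Γ : Ctx Op Base} → {A : VTy Op Base} → Val Γ A → Part (𝓜.ctx Γ ⟶ 𝓜.ty A)
  | _, _, .var x => Part.some (𝓜.var x)
  | _, _, .lam M => (𝓜.comp M).map fun m => 𝓜.curry _ _ _ _ m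
  | _, _, .tuple V => (partPi fun i => 𝓜.val (V i)).map fun v => Pi.lift v
  | _, _, .proj (A := A) i V => (𝓜.val V).map fun v => v ≫ Pi.π (fun i => 𝓜.ty (A i)) i
  | _, _, .inj (A := A) i V => (𝓜.val V).map fun v => v ≫ 𝓜.inj (fun i => 𝓜.ty (A i)) i

/-- Partial interpretation of computation terms. -/
def comp (𝓜 : Model Op Base C) :
    {Γ : Ctx Op Base} → {A : VTy Op Base} → {𝒯 : EffTheory Op Base} → Comp Γ A 𝒯 →
    Part (𝓜.ctx Γ ⟶ (𝓜.T 𝒯).obj (𝓜.ty A))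
  | _, _, _, .app V W =>
      (𝓜.val V).bind fun v => (𝓜.val W).map fun w => lift v w ≫ 𝓜.eval _ _ _
  | _, _, 𝒯, .ret V => (𝓜.val V).map fun v => v ≫ (𝓜.T 𝒯).η.app _
  | _, _, 𝒯, .letIn M N =>
      (𝓜.comp M).bind fun m => (𝓜.comp N).map fun n =>
        lift (𝟙 _) m ≫ (𝓜.T 𝒯).str _ _ ≫ (𝓜.T 𝒯).map n ≫ (𝓜.T 𝒯).μ.app _
  | _, _, 𝒯, .op o V => (𝓜.val V).map fun v => v ≫ 𝓜.op 𝒯 o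
  | _, _, 𝒯, .case V M =>
      (𝓜.val V).bind fun v => (partPi fun i => 𝓜.comp (M i)).map fun m =>
        lift (𝟙 _) v ≫ 𝓜.cotuple 𝒯 m
  | _, B, 𝒯', .handle (𝒯 := 𝒯) M H N =>
      (𝓜.comp M).bind fun m => (partPi fun o => 𝓜.comp (H o)).bind fun c =>
        (𝓜.comp N).bind fun n =>
          Part.assert (𝓜.AlgSat 𝒯.ax 𝒯' (𝓜.ty B) (𝓜.hdlOfClauses c)) fun hc =>
            Part.some (𝓜.handle 𝒯 𝒯' (𝓜.ty B) ⟨𝓜.hdlOfClauses c, hc⟩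
              (lift (𝟙 _) m ≫ (𝓜.T 𝒯).str _ _ ≫ (𝓜.T 𝒯).map n))

end

/-- Partial interpretation of handlers. -/
def handler (𝓜 : Model Op Base C) {Γ : Ctx Op Base} {S : Sig Op Base} {B : VTy Op Base}
    {𝒯' : EffTheory Op Base} (H : Hdl Γ S B 𝒯') :
    Part (𝓜.ctx Γ ⟶ 𝓜.hdl S 𝒯' (𝓜.ty B)) :=
  (partPi fun o => 𝓜.comp (H o)).map fun c => 𝓜.hdlOfClauses c

end Model

end

end EffHandlers

namespace EffHandlers

theorem mem_partPi {ι : Type w} {α : ι → Type v} {p : ∀ i, Part (α i)} {f : ∀ i, α i} :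
    f ∈ partPi p ↔ ∀ i, f i ∈ p i := by
  constructor
  · rintro ⟨h, rfl⟩ i
    exact ⟨h i, rfl⟩
  · intro h
    exact ⟨fun i => (h i).1, funext fun i => (h i).2⟩

theorem whiskerLeft_eq_lift {C : Type u} [Category.{v} C] [CartesianMonoidalCategory C] (X : C)
    {Y Z : C} (f : Y ⟶ Z) : X ◁ f = lift (fst X Y) (snd X Y ≫ f) := by
  ext <;> simp

namespace StrongMonad

variable {C : Type u} [Category.{v} C] [CartesianMonoidalCategory C] (T : StrongMonad C)

/-- The strong functorial action of `n : X × Y ⟶ Z` at a generalized element `m` of `T Y`. -/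
def smap {X Y Z : C} (m : X ⟶ T.obj Y) (n : X ⊗ Y ⟶ Z) : X ⟶ T.obj Z :=
  lift (𝟙 X) m ≫ T.str X Y ≫ T.map n

theorem smap_map {X Y Z W : C} (m : X ⟶ T.obj Y) (n : X ⊗ Y ⟶ Z) (g : Z ⟶ W) :
    T.smap m n ≫ T.map g = T.smap m (n ≫ g) := by
  simp [smap]

theorem comp_smap {X X' Y Z : C} (r : X' ⟶ X) (m : X ⟶ T.obj Y) (n : X ⊗ Y ⟶ Z) :
    r ≫ T.smap m n = T.smap (r ≫ m) ((r ▷ Y) ≫ n) := by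
  have h := T.str_natural r (𝟙 Y)
  simp only [CategoryTheory.Functor.map_id, tensorHom_id] at h
  simp only [smap, Functor.map_comp]
  rw [← reassoc_of% h, comp_lift_assoc, lift_whiskerRight_assoc]
  simp

theorem comp_smap_comp {X X' Y Z W : C} (r : X' ⟶ X) (m : X ⟶ T.obj Y) (n : X ⊗ Y ⟶ Z)
    (g : T.obj Z ⟶ W) : r ≫ T.smap m n ≫ g = T.smap (r ≫ m) ((r ▷ Y) ≫ n) ≫ g := by
  rw [← Category.assoc, comp_smap]

theorem smap_eta {X Y Z : C} (w : X ⟶ Y) (n : X ⊗ Y ⟶ Z) :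
    T.smap (w ≫ T.η.app Y) n = (lift (𝟙 X) w ≫ n) ≫ T.η.app Z := by
  have h := T.str_unit X Y
  have : lift (𝟙 X) (w ≫ T.η.app Y) = lift (𝟙 X) w ≫ (X ◁ T.η.app Y) := by simp
  rw [smap, this, Category.assoc, reassoc_of% h]
  have := T.η.naturality n
  simp only [Functor.id_map] at this
  simp [this]

theorem smap_mu {X Y Z : C} (m : X ⟶ T.obj (T.obj Y)) (n : X ⊗ Y ⟶ Z) :
    T.smap (m ≫ T.μ.app Y) n = T.smap m (T.str X Y ≫ T.map n) ≫ T.μ.app Z := by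
  have h := T.str_mult X Y
  have h1 : lift (𝟙 X) (m ≫ T.μ.app Y) = lift (𝟙 X) m ≫ (X ◁ T.μ.app Y) := by simp
  have h2 := T.μ.naturality n
  simp only [Functor.comp_map] at h2
  rw [smap, h1, Category.assoc, reassoc_of% h]
  simp [smap, h2]

theorem smap_snd {X Y : C} (m : X ⟶ T.obj Y) : T.smap m (snd X Y) = m := by
  have h1 := T.str_natural (toUnit X) (𝟙 Y)
  have h2 := T.str_leftUnitor Y
  have h3 : snd X Y = (toUnit X ⊗ₘ 𝟙 Y) ≫ (λ_ Y).hom := by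
    rw [leftUnitor_hom, tensorHom_snd, Category.comp_id]
  rw [smap, h3, Functor.map_comp, ← reassoc_of% h1, h2]
  simp

theorem smap_smap {X Y Z W : C} (m : X ⟶ T.obj Y) (n : X ⊗ Y ⟶ Z) (g : X ⊗ Z ⟶ W) :
    T.smap (T.smap m n) g = T.smap m (lift (fst X Y) n ≫ g) := by
  have h1 := T.str_natural (𝟙 X) n
  have h2 := T.str_associator X X Y
  have h4 := T.str_natural (lift (𝟙 X) (𝟙 X)) (𝟙 Y)
  simp only [CategoryTheory.Functor.map_id] at h4
  have h3 : lift (𝟙 X) (T.smap m n) =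
      lift (𝟙 X) m ≫ (lift (𝟙 X) (𝟙 X) ⊗ₘ 𝟙 _) ≫ (α_ X X (T.obj Y)).hom ≫ (X ◁ T.str X Y) ≫
        (𝟙 X ⊗ₘ T.map n) := by
    ext <;> simp [smap]
  rw [smap, h3]
  simp only [Category.assoc]
  rw [reassoc_of% h1, ← reassoc_of% h2, reassoc_of% h4]
  rw [smap, ← Functor.map_comp, ← Functor.map_comp, ← Functor.map_comp]
  congr 3
  have h5 : (lift (𝟙 X) (𝟙 X) ▷ Y) ≫ (α_ X X Y).hom ≫ snd X (X ⊗ Y) = 𝟙 _ := by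
    ext <;> simp
  simp only [← Category.assoc]
  congr 1
  ext <;> simp [reassoc_of% h5]

theorem smap_eta_mu {X Y Z : C} (w : X ⟶ Y) (n : X ⊗ Y ⟶ T.obj Z) :
    T.smap (w ≫ T.η.app Y) n ≫ T.μ.app Z = lift (𝟙 X) w ≫ n := by
  rw [smap_eta, Category.assoc, T.left_unit]
  exact Category.comp_id _

theorem smap_snd_eta_mu {X Y : C} (m : X ⟶ T.obj Y) :
    T.smap m (snd X Y ≫ T.η.app Y) ≫ T.μ.app Y = m := by
  rw [← smap_map, smap_snd, Category.assoc, T.right_unit]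
  exact Category.comp_id _

theorem lift_fst_str {X Y Z W : C} (m : X ⊗ Y ⟶ T.obj Z) (n : X ⊗ Z ⟶ W) :
    lift (fst X Y) m ≫ T.str X Z ≫ T.map n = T.smap m ((fst X Y ▷ Z) ≫ n) := by
  have h1 := T.str_natural (fst X Y) (𝟙 Z)
  simp only [CategoryTheory.Functor.map_id] at h1
  rw [StrongMonad.smap, Functor.map_comp, ← tensorHom_id, ← reassoc_of% h1]
  simp only [← Category.assoc]
  congr 2
  ext <;> simp

theorem smap_assoc {X Y Z W : C} (m : X ⟶ T.obj Y) (n : X ⊗ Y ⟶ T.obj Z)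
    (l : X ⊗ Z ⟶ T.obj W) :
    T.smap (T.smap m n ≫ T.μ.app Z) l ≫ T.μ.app W =
      T.smap m (T.smap n ((fst X Y ▷ Z) ≫ l) ≫ T.μ.app W) ≫ T.μ.app W := by
  rw [smap_mu, smap_smap, lift_fst_str, Category.assoc, ← T.assoc, ← Category.assoc, smap_map]

end StrongMonad

namespace PreModel

variable {Op : Type u₁} {Base : Type u₂} {C : Type u} [Category.{v} C]
  [CartesianMonoidalCategory C] (P : PreModel Op Base C)

theorem curry_eval {𝒯 : EffTheory Op Base} {X Y Z : C} (f : X ⊗ Y ⟶ (P.T 𝒯).obj Z) :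
    (P.curry 𝒯 X Y Z f ▷ Y) ≫ P.eval 𝒯 Y Z = f := by
  apply (P.curry 𝒯 X Y Z).injective
  rw [P.curry_natural]
  simp [eval]

theorem lift_curry_eval {𝒯 : EffTheory Op Base} {X W Y Z : C} (f : X ⊗ Y ⟶ (P.T 𝒯).obj Z)
    (r : W ⟶ X) (y : W ⟶ Y) :
    lift (r ≫ P.curry 𝒯 X Y Z f) y ≫ P.eval 𝒯 Y Z = lift r y ≫ f := by
  conv_rhs => rw [← P.curry_eval f]
  simp

theorem lift_id_curry_eval {𝒯 : EffTheory Op Base} {X Y Z : C} (f : X ⊗ Y ⟶ (P.T 𝒯).obj Z)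
    (y : X ⟶ Y) : lift (P.curry 𝒯 X Y Z f) y ≫ P.eval 𝒯 Y Z = lift (𝟙 X) y ≫ f := by
  simpa only [Category.id_comp] using P.lift_curry_eval f (𝟙 X) y

theorem curry_eta {𝒯 : EffTheory Op Base} {X Y Z : C} (g : X ⟶ P.kexp 𝒯 Y Z) :
    P.curry 𝒯 X Y Z ((g ▷ Y) ≫ P.eval 𝒯 Y Z) = g := by
  rw [P.curry_natural]
  simp [eval]

theorem inj_cotuple (𝒯 : EffTheory Op Base) {n : ℕ} {X : Fin n → C} {Z Y : C}
    (f : ∀ i, Z ⊗ X i ⟶ (P.T 𝒯).obj Y) (i : Fin n) :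
    (Z ◁ P.inj X i) ≫ P.cotuple 𝒯 f = f i :=
  ((P.isCoproduct 𝒯 X).distrib Z Y f).choose_spec.1 i

theorem lift_inj_cotuple (𝒯 : EffTheory Op Base) {n : ℕ} {X : Fin n → C} {Z Y : C}
    (f : ∀ i, Z ⊗ X i ⟶ (P.T 𝒯).obj Y) (i : Fin n) (v : Z ⟶ X i) :
    lift (𝟙 Z) (v ≫ P.inj X i) ≫ P.cotuple 𝒯 f = lift (𝟙 Z) v ≫ f i := by
  rw [← P.inj_cotuple 𝒯 f i, lift_whiskerLeft_assoc]

theorem cotuple_unique (𝒯 : EffTheory Op Base) {n : ℕ} {X : Fin n → C} {Z Y : C}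
    (f : ∀ i, Z ⊗ X i ⟶ (P.T 𝒯).obj Y) (g : Z ⊗ P.sum X ⟶ (P.T 𝒯).obj Y)
    (h : ∀ i, (Z ◁ P.inj X i) ≫ g = f i) : g = P.cotuple 𝒯 f :=
  ((P.isCoproduct 𝒯 X).distrib Z Y f).choose_spec.2 g h

theorem comp_cotuple (𝒯 : EffTheory Op Base) {n : ℕ} {X : Fin n → C} {Z Z' Y : C}
    (r : Z' ⟶ Z) (f : ∀ i, Z ⊗ X i ⟶ (P.T 𝒯).obj Y) :
    (r ▷ P.sum X) ≫ P.cotuple 𝒯 f = P.cotuple 𝒯 fun i => (r ▷ X i) ≫ f i := by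
  apply P.cotuple_unique
  intro i
  rw [← inj_cotuple P 𝒯 f i, whisker_exchange_assoc]

theorem lift_cotuple (𝒯 : EffTheory Op Base) {n : ℕ} {X : Fin n → C} {Z Z' Y : C}
    (r : Z' ⟶ Z) (v : Z' ⟶ P.sum X) (f : ∀ i, Z ⊗ X i ⟶ (P.T 𝒯).obj Y) :
    lift r v ≫ P.cotuple 𝒯 f = lift (𝟙 _) v ≫ P.cotuple 𝒯 fun i => (r ▷ X i) ≫ f i := by
  rw [← comp_cotuple]
  simp

theorem lift_whisker_rearrange {Y D K B Z : C} (h : Z ⟶ Y) (s : Z ⟶ D) (k : Z ⟶ K) :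
    (lift h (lift s k) ▷ B) ≫ rearrange Y D K B =
      lift (fst Z B ≫ h) (lift (s ▷ B) (fst Z B ≫ k)) := by
  simp only [rearrange]
  ext <;> simp

end PreModel

end EffHandlers

namespace EffHandlers

theorem mem_part_of_eq {α : Type*} {p : Part α} {a b : α} (e : a = b) (h : b ∈ p) : a ∈ p :=
  e ▸ h

theorem mem_part_map {α β : Type*} {f : α → β} {p : Part α} {b : β} :
    b ∈ p.map f ↔ ∃ a ∈ p, b = f a := by
  simp [eq_comm]

theorem mem_part_bind_map {α β γ : Type*} {p : Part α} {q : Part β} {f : α → β → γ} {c : γ} :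
    (c ∈ p.bind fun a => q.map (f a)) ↔ ∃ a ∈ p, ∃ b ∈ q, c = f a b := by
  simp [eq_comm]

theorem mem_partPi_map {ι : Type*} {α : ι → Type*} {β : Type*} {p : ∀ i, Part (α i)}
    {f : (∀ i, α i) → β} {b : β} :
    b ∈ (partPi p).map f ↔ ∃ a : ∀ i, α i, (∀ i, a i ∈ p i) ∧ b = f a := by
  simp [mem_partPi, eq_comm]

namespace PreModel

variable {Op : Type u₁} {Base : Type u₂} {C : Type u} [Category.{v} C]
  [CartesianMonoidalCategory C] (P : PreModel Op Base C)
  {S : Sig Op Base} {𝒯 𝒯' : EffTheory Op Base}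

/-- Tupling of curried operation clauses. -/
noncomputable def tupleClauses {G X : C}
    (c : ∀ o : S.Ops, (G ⊗ P.gty (S.arg o)) ⊗ P.kexp 𝒯' (P.gty (S.res o)) X ⟶ (P.T 𝒯').obj X) :
    G ⟶ P.hdl S 𝒯' X :=
  Pi.lift fun o => P.curry 𝒯' _ _ _ ((α_ _ _ _).inv ≫ c o)

theorem comp_tupleClauses {G G' X : C} (r : G' ⟶ G)
    (c : ∀ o : S.Ops, (G ⊗ P.gty (S.arg o)) ⊗ P.kexp 𝒯' (P.gty (S.res o)) X ⟶ (P.T 𝒯').obj X) :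
    P.tupleClauses (fun o => ((r ▷ _) ▷ _) ≫ c o) = r ≫ P.tupleClauses c := by
  apply Pi.hom_ext
  intro o
  simp only [tupleClauses, Pi.lift_π, Category.assoc]
  rw [← P.curry_natural]
  simp

theorem tupleClauses_eval {G X Z : C}
    (c : ∀ o : S.Ops, (G ⊗ P.gty (S.arg o)) ⊗ P.kexp 𝒯' (P.gty (S.res o)) X ⟶ (P.T 𝒯').obj X)
    (o : S.Ops) (r : Z ⟶ G) (v : Z ⟶ P.gty (S.arg o))
    (k : Z ⟶ P.kexp 𝒯' (P.gty (S.res o)) X) :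
    lift (r ≫ P.tupleClauses c ≫ Pi.π (P.clause S 𝒯' X) o) (lift v k) ≫ P.eval 𝒯' _ X =
      lift (lift r v) k ≫ c o := by
  simp only [tupleClauses, Pi.lift_π]
  rw [P.lift_curry_eval]
  simp only [← Category.assoc]
  congr 1
  ext <;> simp

theorem lift_algUncurried_letOp {Δ : List (GTy Base)} {A : GTy Base} (o : S.Ops)
    (V : GTm Δ (S.arg o)) (M : ETm S (S.res o :: Δ) A) {X Z : C} (h : Z ⟶ P.hdl S 𝒯' X)
    (s : Z ⟶ P.gctx Δ) (k : Z ⟶ P.kexp 𝒯' (P.gty A) X) :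
    lift h (lift s k) ≫ P.algUncurried 𝒯' X (.letOp o V M) =
      lift (h ≫ Pi.π (P.clause S 𝒯' X) o)
        (lift (s ≫ P.gtm V) (P.curry 𝒯' Z (P.gty (S.res o)) X
          (lift (fst _ _ ≫ h) (lift (s ▷ P.gty (S.res o)) (fst _ _ ≫ k)) ≫
            P.algUncurried 𝒯' X M))) ≫ P.eval 𝒯' _ X := by
  have e : ∀ a : P.hdl S 𝒯' X ⊗ ((P.gctx Δ ⊗ P.gty (S.res o)) ⊗ P.kexp 𝒯' (P.gty A) X) ⟶
      (P.T 𝒯').obj X,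
      lift h (lift s k) ≫ lift (fst _ _ ≫ Pi.π (P.clause S 𝒯' X) o)
        (lift (snd _ _ ≫ fst _ _ ≫ P.gtm V) (P.curry 𝒯' _ _ X (rearrange _ _ _ _ ≫ a))) ≫
          P.eval 𝒯' _ X =
      lift (h ≫ Pi.π (P.clause S 𝒯' X) o)
        (lift (s ≫ P.gtm V) (P.curry 𝒯' Z (P.gty (S.res o)) X
          (lift (fst _ _ ≫ h) (lift (s ▷ P.gty (S.res o)) (fst _ _ ≫ k)) ≫ a))) ≫
            P.eval 𝒯' _ X := by
    intro a
    rw [← lift_whisker_rearrange, Category.assoc, P.curry_natural]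
    rw [comp_lift_assoc, comp_lift, lift_fst_assoc, lift_snd_assoc, lift_fst_assoc]
  exact e _

theorem lift_algUncurried_case {Δ : List (GTy Base)} {A : GTy Base} {n : ℕ} {B : Fin n → GTy Base}
    (V : GTm Δ (.sum n B)) (M : ∀ i, ETm S (B i :: Δ) A) {X Z : C} (h : Z ⟶ P.hdl S 𝒯' X)
    (s : Z ⟶ P.gctx Δ) (k : Z ⟶ P.kexp 𝒯' (P.gty A) X) :
    lift h (lift s k) ≫ P.algUncurried 𝒯' X (.case V M) =
      lift (𝟙 Z) (s ≫ P.gtm V) ≫ P.cotuple 𝒯' (X := fun i => P.gty (B i)) fun i =>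
        lift (fst _ _ ≫ h) (lift (s ▷ P.gty (B i)) (fst _ _ ≫ k)) ≫
          P.algUncurried 𝒯' X (M i) := by
  have e : ∀ (v : P.gctx Δ ⟶ P.sum fun i => P.gty (B i))
      (a : ∀ i, P.hdl S 𝒯' X ⊗ ((P.gctx Δ ⊗ P.gty (B i)) ⊗ P.kexp 𝒯' (P.gty A) X) ⟶
        (P.T 𝒯').obj X),
      lift h (lift s k) ≫ lift (𝟙 _) (snd _ _ ≫ fst _ _ ≫ v) ≫
        P.cotuple 𝒯' (fun i => rearrange _ _ _ _ ≫ a i) =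
      lift (𝟙 Z) (s ≫ v) ≫ P.cotuple 𝒯' fun i =>
        lift (fst _ _ ≫ h) (lift (s ▷ P.gty (B i)) (fst _ _ ≫ k)) ≫ a i := by
    intro v a
    have e' : (fun i => lift (fst Z (P.gty (B i)) ≫ h)
        (lift (s ▷ P.gty (B i)) (fst _ _ ≫ k)) ≫ a i) =
        fun i => (lift h (lift s k) ▷ P.gty (B i)) ≫ rearrange _ _ _ _ ≫ a i :=
      funext fun i => by rw [← lift_whisker_rearrange, Category.assoc]
    rw [e', ← lift_cotuple, comp_lift_assoc, Category.comp_id, lift_snd_assoc, lift_fst_assoc]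
  exact e _ _

end PreModel

namespace Model

variable {Op : Type u₁} {Base : Type u₂} {C : Type u} [Category.{v} C]
  [CartesianMonoidalCategory C] (𝓜 : Model Op Base C)

section Membership

variable {Γ : Ctx Op Base} {A B : VTy Op Base} {𝒯 𝒯' : EffTheory Op Base}

theorem mem_val_var {x : Var Γ A} {v} : v ∈ 𝓜.val (.var x) ↔ v = 𝓜.var x :=
  Part.mem_some_iff

theorem mem_val_lam {M : Comp (A :: Γ) B 𝒯} {v} :
    v ∈ 𝓜.val (.lam M) ↔ ∃ m ∈ 𝓜.comp M, v = 𝓜.curry 𝒯 (𝓜.ctx Γ) (𝓜.ty A) (𝓜.ty B) m :=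
  mem_part_map

theorem mem_val_tuple {n : ℕ} {A : Fin n → VTy Op Base} {V : ∀ i, Val Γ (A i)} {v} :
    v ∈ 𝓜.val (.tuple V) ↔
      ∃ w : ∀ i, 𝓜.ctx Γ ⟶ 𝓜.ty (A i), (∀ i, w i ∈ 𝓜.val (V i)) ∧ v = Pi.lift w :=
  mem_partPi_map

theorem mem_val_proj {n : ℕ} {A : Fin n → VTy Op Base} {i : Fin n}
    {V : Val Γ (.prod n A)} {v} :
    v ∈ 𝓜.val (.proj i V) ↔ ∃ w ∈ 𝓜.val V, v = w ≫ Pi.π (fun i => 𝓜.ty (A i)) i :=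
  mem_part_map

theorem mem_val_inj {n : ℕ} {A : Fin n → VTy Op Base} {i : Fin n} {V : Val Γ (A i)} {v} :
    v ∈ 𝓜.val (.inj (A := A) i V) ↔ ∃ w ∈ 𝓜.val V, v = w ≫ 𝓜.inj (fun i => 𝓜.ty (A i)) i :=
  mem_part_map

theorem mem_comp_app {V : Val Γ (.fn A B 𝒯)} {W : Val Γ A} {m} :
    m ∈ 𝓜.comp (.app V W) ↔
      ∃ v ∈ 𝓜.val V, ∃ w ∈ 𝓜.val W, m = lift v w ≫ 𝓜.eval 𝒯 (𝓜.ty A) (𝓜.ty B) :=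
  mem_part_bind_map

theorem mem_comp_ret {V : Val Γ A} {m} :
    m ∈ 𝓜.comp (.ret (𝒯 := 𝒯) V) ↔ ∃ v ∈ 𝓜.val V, m = v ≫ (𝓜.T 𝒯).η.app (𝓜.ty A) :=
  mem_part_map

theorem mem_comp_letIn {M : Comp Γ A 𝒯} {N : Comp (A :: Γ) B 𝒯} {k} :
    k ∈ 𝓜.comp (.letIn M N) ↔
      ∃ m ∈ 𝓜.comp M, ∃ n : 𝓜.ctx Γ ⊗ 𝓜.ty A ⟶ (𝓜.T 𝒯).obj (𝓜.ty B), n ∈ 𝓜.comp N ∧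
        k = (𝓜.T 𝒯).smap (X := 𝓜.ctx Γ) m n ≫ (𝓜.T 𝒯).μ.app (𝓜.ty B) := by
  refine mem_part_bind_map.trans ?_
  simp only [StrongMonad.smap, Category.assoc]
  rfl

theorem mem_comp_op {o : 𝒯.sig.Ops} {V : Val Γ ((𝒯.sig.arg o).toVTy Op)} {m} :
    m ∈ 𝓜.comp (.op o V) ↔ ∃ v ∈ 𝓜.val V, m = v ≫ 𝓜.op 𝒯 o :=
  mem_part_map

theorem mem_comp_case {n : ℕ} {A : Fin n → VTy Op Base} {V : Val Γ (.sum n A)}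
    {M : ∀ i, Comp (A i :: Γ) B 𝒯} {k} :
    k ∈ 𝓜.comp (.case V M) ↔
      ∃ v ∈ 𝓜.val V, ∃ m : ∀ i, 𝓜.ctx Γ ⊗ 𝓜.ty (A i) ⟶ (𝓜.T 𝒯).obj (𝓜.ty B),
        (∀ i, m i ∈ 𝓜.comp (M i)) ∧ k = lift (𝟙 (𝓜.ctx Γ)) v ≫ 𝓜.cotuple 𝒯 m :=
  mem_part_bind_map.trans <| exists_congr fun _ => and_congr_right fun _ => exists_congr fun _ =>
    and_congr_left' mem_partPi

theorem mem_handler {S : Sig Op Base} {H : Hdl Γ S B 𝒯'} {h} :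
    h ∈ 𝓜.handler H ↔
      ∃ c : ∀ o : S.Ops,
        (𝓜.ctx Γ ⊗ 𝓜.gty (S.arg o)) ⊗ 𝓜.kexp 𝒯' (𝓜.gty (S.res o)) (𝓜.ty B) ⟶
          (𝓜.T 𝒯').obj (𝓜.ty B),
        (∀ o, c o ∈ 𝓜.comp (H o)) ∧ h = 𝓜.tupleClauses c :=
  mem_partPi_map

theorem mem_comp_handle {M : Comp Γ A 𝒯} {H : Hdl Γ 𝒯.sig B 𝒯'}
    {N : Comp (A :: Γ) B 𝒯'} {k} :
    k ∈ 𝓜.comp (.handle M H N) ↔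
      ∃ m ∈ 𝓜.comp M, ∃ n : 𝓜.ctx Γ ⊗ 𝓜.ty A ⟶ (𝓜.T 𝒯').obj (𝓜.ty B), n ∈ 𝓜.comp N ∧
        ∃ h : 𝓜.HSat 𝒯 𝒯' (𝓜.ty B) (𝓜.ctx Γ),
        h.1 ∈ 𝓜.handler H ∧
          k = 𝓜.handle 𝒯 𝒯' (𝓜.ty B) h ((𝓜.T 𝒯).smap (X := 𝓜.ctx Γ) m n) := by
  simp only [comp, Part.mem_bind_iff, Part.mem_assert_iff, Part.mem_some_iff, mem_partPi,
    mem_handler]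
  constructor
  · rintro ⟨m, hm, c, hc, n, hn, hs, rfl⟩
    exact ⟨m, hm, n, hn, ⟨_, hs⟩, ⟨c, hc, rfl⟩, rfl⟩
  · rintro ⟨m, hm, n, hn, ⟨_, hs⟩, ⟨c, hc, rfl⟩, rfl⟩
    exact ⟨m, hm, c, hc, n, hn, hs, rfl⟩

end Membership

section Handlers

variable {𝒯 𝒯' : EffTheory Op Base}

theorem comp_handle_smap {A X Z Z' : C} (r : Z' ⟶ Z) (h : 𝓜.HSat 𝒯 𝒯' X Z)
    (m : Z ⟶ (𝓜.T 𝒯).obj A) (n : Z ⊗ A ⟶ (𝓜.T 𝒯').obj X) :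
    r ≫ 𝓜.handle 𝒯 𝒯' X h ((𝓜.T 𝒯).smap m n) =
      𝓜.handle 𝒯 𝒯' X (h.comp r) ((𝓜.T 𝒯).smap (r ≫ m) ((r ▷ A) ≫ n)) := by
  rw [𝓜.handle_natural, StrongMonad.comp_smap]

theorem handle_smap_unit {A X Z : C} (h : 𝓜.HSat 𝒯 𝒯' X Z) (v : Z ⟶ A)
    (n : Z ⊗ A ⟶ (𝓜.T 𝒯').obj X) :
    𝓜.handle 𝒯 𝒯' X h ((𝓜.T 𝒯).smap (v ≫ (𝓜.T 𝒯).η.app A) n) = lift (𝟙 Z) v ≫ n := by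
  rw [StrongMonad.smap_eta, 𝓜.handle_unit]

theorem handle_smap_mult {A A' X Z : C} (h : 𝓜.HSat 𝒯 𝒯' X Z) (l : Z ⟶ (𝓜.T 𝒯).obj A)
    (m : Z ⊗ A ⟶ (𝓜.T 𝒯).obj A') (n : Z ⊗ A' ⟶ (𝓜.T 𝒯').obj X) :
    𝓜.handle 𝒯 𝒯' X h ((𝓜.T 𝒯).smap ((𝓜.T 𝒯).smap l m ≫ (𝓜.T 𝒯).μ.app A') n) =
      𝓜.handle 𝒯 𝒯' X h ((𝓜.T 𝒯).smap l
        (𝓜.handle 𝒯 𝒯' X (h.comp (fst Z A)) ((𝓜.T 𝒯).smap m ((fst Z A ▷ A') ≫ n)))) := by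
  rw [StrongMonad.smap_mu, 𝓜.handle_mult, StrongMonad.smap_smap]
  change 𝓜.handle 𝒯 𝒯' X h ((𝓜.T 𝒯).smap _ _) = _
  rw [StrongMonad.smap_smap]
  congr 2
  rw [StrongMonad.lift_fst_str, 𝓜.handle_natural]
  have e1 : lift (fst Z A) ((𝓜.T 𝒯).smap m ((fst Z A ▷ A') ≫ n)) ≫ snd Z _ =
    (𝓜.T 𝒯).smap m ((fst Z A ▷ A') ≫ n) := lift_snd _ _
  rw [e1]
  congr 1
  apply Subtype.ext
  change _ ≫ _ ≫ _ = _ ≫ _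
  rw [lift_fst_assoc]

theorem handle_smap_op {X Z : C} (h : 𝓜.HSat 𝒯 𝒯' X Z) (o : 𝒯.sig.Ops)
    (v : Z ⟶ 𝓜.gty (𝒯.sig.arg o)) (n : Z ⊗ 𝓜.gty (𝒯.sig.res o) ⟶ (𝓜.T 𝒯').obj X) :
    𝓜.handle 𝒯 𝒯' X h ((𝓜.T 𝒯).smap (v ≫ 𝓜.op 𝒯 o) n) =
      lift (h.1 ≫ Pi.π (𝓜.clause 𝒯.sig 𝒯' X) o) (lift v (𝓜.curry 𝒯' _ _ _ n)) ≫
        𝓜.eval 𝒯' _ X := by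
  rw [← 𝓜.handle_op]
  congr 1
  have h1 := (𝓜.T 𝒯).str_natural (𝓜.curry 𝒯' _ _ _ n) (𝟙 (𝓜.gty (𝒯.sig.res o)))
  simp only [CategoryTheory.Functor.map_id] at h1
  conv_lhs => rw [StrongMonad.smap, ← 𝓜.curry_eval n, Functor.map_comp, ← tensorHom_id,
    ← reassoc_of% h1]
  simp only [PreModel.mixedAlgOp, ← Category.assoc]
  congr 2
  ext <;> simp

theorem handle_smap_op_tupleClauses {X Z : C} (h : 𝓜.HSat 𝒯 𝒯' X Z)
    (c : ∀ o : 𝒯.sig.Ops, (Z ⊗ 𝓜.gty (𝒯.sig.arg o)) ⊗ 𝓜.kexp 𝒯' (𝓜.gty (𝒯.sig.res o)) X ⟶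
      (𝓜.T 𝒯').obj X) (e : h.1 = 𝓜.tupleClauses c) (o : 𝒯.sig.Ops)
    (v : Z ⟶ 𝓜.gty (𝒯.sig.arg o)) (n : Z ⊗ 𝓜.gty (𝒯.sig.res o) ⟶ (𝓜.T 𝒯').obj X) :
    𝓜.handle 𝒯 𝒯' X h ((𝓜.T 𝒯).smap (v ≫ 𝓜.op 𝒯 o) n) =
      lift (lift (𝟙 Z) v) (𝓜.curry 𝒯' _ _ _ n) ≫ c o := by
  rw [handle_smap_op, e, ← 𝓜.tupleClauses_eval, Category.id_comp]

end Handlers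
end Model
end EffHandlers

namespace EffHandlers
namespace Model

variable {Op : Type u₁} {Base : Type u₂} {C : Type u} [Category.{v} C]
  [CartesianMonoidalCategory C] (𝓜 : Model Op Base C)

/-- A morphism that interprets a renaming. -/
def RenSem {Γ Δ : Ctx Op Base} (ρ : Ren Γ Δ) (r : 𝓜.ctx Δ ⟶ 𝓜.ctx Γ) : Prop :=
  ∀ (A : VTy Op Base) (x : Var Γ A), r ≫ 𝓜.var x = 𝓜.var (ρ A x)

/-- A morphism that interprets a substitution. -/
def SubSem {Γ Δ : Ctx Op Base} (σ : Sub Γ Δ) (s : 𝓜.ctx Δ ⟶ 𝓜.ctx Γ) : Prop :=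
  ∀ (A : VTy Op Base) (x : Var Γ A), s ≫ 𝓜.var x ∈ 𝓜.val (σ A x)

/-- A morphism that interprets a substitution for a ground context. -/
def GSubSem {Δ : List (GTy Base)} {Γ : Ctx Op Base} (σ : GSub Δ Γ) (s : 𝓜.ctx Γ ⟶ 𝓜.gctx Δ) :
    Prop :=
  ∀ (A : GTy Base) (x : Var Δ A), s ≫ 𝓜.gvar x ∈ 𝓜.val (σ A x)

variable {𝓜}

theorem RenSem.lift {Γ Δ : Ctx Op Base} {ρ : Ren Γ Δ} {r : 𝓜.ctx Δ ⟶ 𝓜.ctx Γ}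
    (h : 𝓜.RenSem ρ r) (B : VTy Op Base) : 𝓜.RenSem (ρ.lift B) (r ▷ 𝓜.ty B)
  | _, .here => whiskerRight_snd r _
  | _, .there x => by
      have := h _ x
      change (r ▷ 𝓜.ty B) ≫ fst _ _ ≫ 𝓜.var x = fst _ _ ≫ 𝓜.var _
      rw [whiskerRight_fst_assoc, this]

theorem renSem_wk (Γ : Ctx Op Base) (B : VTy Op Base) :
    𝓜.RenSem (Ren.wk Γ B) (fst (𝓜.ctx Γ) (𝓜.ty B)) := fun _ _ => rfl

theorem tuple_eta {n : ℕ} (A : Fin n → C) {X : C} (v : X ⟶ ∏ᶜ A) :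
    v = Pi.lift fun i => v ≫ Pi.π A i := by
  apply Pi.hom_ext
  simp

theorem comp_tuple {n : ℕ} {A : Fin n → C} {X Y : C} (r : Y ⟶ X) (w : ∀ i, X ⟶ A i) :
    r ≫ Pi.lift w = Pi.lift fun i => r ≫ w i := by
  apply Pi.hom_ext
  simp

variable (𝓜) in
theorem comp_case {Y X Z : C} {n : ℕ} {A : Fin n → C} {𝒯 : EffTheory Op Base} (r : Y ⟶ X)
    (v : X ⟶ 𝓜.sum A) (m : ∀ i, X ⊗ A i ⟶ (𝓜.T 𝒯).obj Z) :
    r ≫ CartesianMonoidalCategory.lift (𝟙 X) v ≫ 𝓜.cotuple 𝒯 m =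
      CartesianMonoidalCategory.lift (𝟙 Y) (r ≫ v) ≫ 𝓜.cotuple 𝒯 fun i => (r ▷ A i) ≫ m i := by
  rw [← PreModel.lift_cotuple, comp_lift_assoc, Category.comp_id]

mutual

theorem mem_val_ren : {Γ : Ctx Op Base} → {A : VTy Op Base} → (V : Val Γ A) →
    {Δ : Ctx Op Base} → {ρ : Ren Γ Δ} → {r : 𝓜.ctx Δ ⟶ 𝓜.ctx Γ} → 𝓜.RenSem ρ r →
    {v : 𝓜.ctx Γ ⟶ 𝓜.ty A} → v ∈ 𝓜.val V → r ≫ v ∈ 𝓜.val (V.ren ρ)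
  | _, _, .var x, _, _, _, hr, _, hv => by
      obtain rfl := 𝓜.mem_val_var.1 hv
      exact 𝓜.mem_val_var.2 (hr _ x)
  | _, _, .lam M, _, _, r, hr, _, hv => by
      obtain ⟨m, hm, rfl⟩ := 𝓜.mem_val_lam.1 hv
      exact 𝓜.mem_val_lam.2 ⟨_, mem_comp_ren M (hr.lift _) hm, (𝓜.curry_natural _ r m).symm⟩
  | _, _, .tuple V, _, _, r, hr, _, hv => by
      obtain ⟨w, hw, rfl⟩ := 𝓜.mem_val_tuple.1 hv
      exact 𝓜.mem_val_tuple.2 ⟨_, fun i => mem_val_ren (V i) hr (hw i), comp_tuple r w⟩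
  | _, _, .proj (A := A) i V, _, _, r, hr, _, hv => by
      obtain ⟨w, hw, rfl⟩ := 𝓜.mem_val_proj.1 hv
      exact 𝓜.mem_val_proj.2 ⟨_, mem_val_ren V hr hw, (Category.assoc _ _ _).symm⟩
  | _, _, .inj (A := A) i V, _, _, r, hr, _, hv => by
      obtain ⟨w, hw, rfl⟩ := 𝓜.mem_val_inj.1 hv
      exact 𝓜.mem_val_inj.2 ⟨_, mem_val_ren V hr hw, (Category.assoc _ _ _).symm⟩

theorem mem_comp_ren : {Γ : Ctx Op Base} → {A : VTy Op Base} → {𝒯 : EffTheory Op Base} →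
    (M : Comp Γ A 𝒯) → {Δ : Ctx Op Base} → {ρ : Ren Γ Δ} → {r : 𝓜.ctx Δ ⟶ 𝓜.ctx Γ} →
    𝓜.RenSem ρ r → {m : 𝓜.ctx Γ ⟶ (𝓜.T 𝒯).obj (𝓜.ty A)} → m ∈ 𝓜.comp M →
    r ≫ m ∈ 𝓜.comp (M.ren ρ)
  | _, _, _, .app V W, _, _, r, hr, _, hk => by
      obtain ⟨v, hv, w, hw, rfl⟩ := 𝓜.mem_comp_app.1 hk
      exact 𝓜.mem_comp_app.2
        ⟨_, mem_val_ren V hr hv, _, mem_val_ren W hr hw, comp_lift_assoc _ _ _ _⟩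
  | _, _, _, .ret V, _, _, r, hr, _, hk => by
      obtain ⟨v, hv, rfl⟩ := 𝓜.mem_comp_ret.1 hk
      exact 𝓜.mem_comp_ret.2 ⟨_, mem_val_ren V hr hv, (Category.assoc _ _ _).symm⟩
  | _, _, _, .letIn M N, _, _, r, hr, _, hk => by
      obtain ⟨m, hm, n, hn, rfl⟩ := 𝓜.mem_comp_letIn.1 hk
      refine 𝓜.mem_comp_letIn.2 ⟨_, mem_comp_ren M hr hm, _, mem_comp_ren N (hr.lift _) hn, ?_⟩
      exact StrongMonad.comp_smap_comp _ _ _ _ _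
  | _, _, _, .op o V, _, _, r, hr, _, hk => by
      obtain ⟨v, hv, rfl⟩ := 𝓜.mem_comp_op.1 hk
      exact 𝓜.mem_comp_op.2 ⟨_, mem_val_ren V hr hv, (Category.assoc _ _ _).symm⟩
  | _, _, _, .case (A := A) V M, _, _, r, hr, _, hk => by
      obtain ⟨v, hv, m, hm, rfl⟩ := 𝓜.mem_comp_case.1 hk
      exact 𝓜.mem_comp_case.2 ⟨_, mem_val_ren V hr hv, _,
        fun i => mem_comp_ren (M i) (hr.lift _) (hm i), 𝓜.comp_case r v m⟩
  | _, _, _, .handle M H N, _, _, r, hr, _, hk => by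
      obtain ⟨m, hm, n, hn, h, hh, rfl⟩ := 𝓜.mem_comp_handle.1 hk
      obtain ⟨c, hc, e⟩ := 𝓜.mem_handler.1 hh
      refine 𝓜.mem_comp_handle.2 ⟨_, mem_comp_ren M hr hm, _, mem_comp_ren N (hr.lift _) hn,
        h.comp r, ?_, ?_⟩
      · exact 𝓜.mem_handler.2 ⟨_, fun o => mem_comp_ren (H o) ((hr.lift _).lift _) (hc o),
          (congrArg (r ≫ ·) e).trans (𝓜.comp_tupleClauses r c).symm⟩
      · exact 𝓜.comp_handle_smap r h m n

end

theorem mem_handler_ren {Γ Δ : Ctx Op Base} {S : Sig Op Base} {B : VTy Op Base}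
    {𝒯' : EffTheory Op Base} {H : Hdl Γ S B 𝒯'} {ρ : Ren Γ Δ} {r : 𝓜.ctx Δ ⟶ 𝓜.ctx Γ}
    (hr : 𝓜.RenSem ρ r) {h : 𝓜.ctx Γ ⟶ 𝓜.hdl S 𝒯' (𝓜.ty B)} (hh : h ∈ 𝓜.handler H) :
    r ≫ h ∈ 𝓜.handler (H.ren ρ) := by
  obtain ⟨c, hc, rfl⟩ := 𝓜.mem_handler.1 hh
  exact 𝓜.mem_handler.2 ⟨_, fun o => mem_comp_ren (H o) ((hr.lift _).lift _) (hc o),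
    (𝓜.comp_tupleClauses r c).symm⟩

theorem SubSem.cons {Γ Δ : Ctx Op Base} {σ : Sub Γ Δ} {s : 𝓜.ctx Δ ⟶ 𝓜.ctx Γ}
    (h : 𝓜.SubSem σ s) {B : VTy Op Base} {W : Val Δ B} {w : 𝓜.ctx Δ ⟶ 𝓜.ty B}
    (hw : w ∈ 𝓜.val W) : 𝓜.SubSem (Γ := B :: Γ) (σ.cons W) (CartesianMonoidalCategory.lift s w)
  | _, .here => by
      change CartesianMonoidalCategory.lift s w ≫ snd _ _ ∈ 𝓜.val W
      rwa [lift_snd]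
  | _, .there x => by
      change CartesianMonoidalCategory.lift s w ≫ fst _ _ ≫ 𝓜.var x ∈ 𝓜.val (σ _ x)
      rw [lift_fst_assoc]
      exact h _ x

theorem subSem_id (Γ : Ctx Op Base) : 𝓜.SubSem (Sub.id Γ) (𝟙 (𝓜.ctx Γ)) := fun _ _ =>
  𝓜.mem_val_var.2 (Category.id_comp _)

theorem subSem_wk (Γ : Ctx Op Base) (B : VTy Op Base) :
    𝓜.SubSem (Δ := B :: Γ) (fun _ (x : Var Γ _) => .var (.there x)) (fst (𝓜.ctx Γ) (𝓜.ty B)) :=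
  fun _ _ => 𝓜.mem_val_var.2 rfl

theorem SubSem.lift {Γ Δ : Ctx Op Base} {σ : Sub Γ Δ} {s : 𝓜.ctx Δ ⟶ 𝓜.ctx Γ}
    (h : 𝓜.SubSem σ s) (B : VTy Op Base) : 𝓜.SubSem (σ.lift B) (s ▷ 𝓜.ty B) := by
  have e : s ▷ 𝓜.ty B = CartesianMonoidalCategory.lift (fst _ _ ≫ s) (snd _ _) := by
    ext <;> simp
  rw [e]
  refine SubSem.cons (Δ := B :: Δ) (fun A x => ?_) (𝓜.mem_val_var.2 rfl)
  exact mem_part_of_eq (Category.assoc _ _ _) (mem_val_ren (σ A x) (renSem_wk Δ B) (h A x))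

mutual

theorem mem_val_subst : {Γ : Ctx Op Base} → {A : VTy Op Base} → (V : Val Γ A) →
    {Δ : Ctx Op Base} → {σ : Sub Γ Δ} → {r : 𝓜.ctx Δ ⟶ 𝓜.ctx Γ} → 𝓜.SubSem σ r →
    {v : 𝓜.ctx Γ ⟶ 𝓜.ty A} → v ∈ 𝓜.val V → r ≫ v ∈ 𝓜.val (V.subst σ)
  | _, _, .var x, _, _, _, hr, _, hv => by
      obtain rfl := 𝓜.mem_val_var.1 hv
      exact hr _ x
  | _, _, .lam M, _, _, r, hr, _, hv => by
      obtain ⟨m, hm, rfl⟩ := 𝓜.mem_val_lam.1 hv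
      exact 𝓜.mem_val_lam.2 ⟨_, mem_comp_subst M (hr.lift _) hm, (𝓜.curry_natural _ r m).symm⟩
  | _, _, .tuple V, _, _, r, hr, _, hv => by
      obtain ⟨w, hw, rfl⟩ := 𝓜.mem_val_tuple.1 hv
      exact 𝓜.mem_val_tuple.2 ⟨_, fun i => mem_val_subst (V i) hr (hw i), comp_tuple r w⟩
  | _, _, .proj (A := A) i V, _, _, r, hr, _, hv => by
      obtain ⟨w, hw, rfl⟩ := 𝓜.mem_val_proj.1 hv
      exact 𝓜.mem_val_proj.2 ⟨_, mem_val_subst V hr hw, (Category.assoc _ _ _).symm⟩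
  | _, _, .inj (A := A) i V, _, _, r, hr, _, hv => by
      obtain ⟨w, hw, rfl⟩ := 𝓜.mem_val_inj.1 hv
      exact 𝓜.mem_val_inj.2 ⟨_, mem_val_subst V hr hw, (Category.assoc _ _ _).symm⟩

theorem mem_comp_subst : {Γ : Ctx Op Base} → {A : VTy Op Base} → {𝒯 : EffTheory Op Base} →
    (M : Comp Γ A 𝒯) → {Δ : Ctx Op Base} → {σ : Sub Γ Δ} → {r : 𝓜.ctx Δ ⟶ 𝓜.ctx Γ} →
    𝓜.SubSem σ r → {m : 𝓜.ctx Γ ⟶ (𝓜.T 𝒯).obj (𝓜.ty A)} → m ∈ 𝓜.comp M →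
    r ≫ m ∈ 𝓜.comp (M.subst σ)
  | _, _, _, .app V W, _, _, r, hr, _, hk => by
      obtain ⟨v, hv, w, hw, rfl⟩ := 𝓜.mem_comp_app.1 hk
      exact 𝓜.mem_comp_app.2
        ⟨_, mem_val_subst V hr hv, _, mem_val_subst W hr hw, comp_lift_assoc _ _ _ _⟩
  | _, _, _, .ret V, _, _, r, hr, _, hk => by
      obtain ⟨v, hv, rfl⟩ := 𝓜.mem_comp_ret.1 hk
      exact 𝓜.mem_comp_ret.2 ⟨_, mem_val_subst V hr hv, (Category.assoc _ _ _).symm⟩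
  | _, _, _, .letIn M N, _, _, r, hr, _, hk => by
      obtain ⟨m, hm, n, hn, rfl⟩ := 𝓜.mem_comp_letIn.1 hk
      refine 𝓜.mem_comp_letIn.2
        ⟨_, mem_comp_subst M hr hm, _, mem_comp_subst N (hr.lift _) hn, ?_⟩
      exact StrongMonad.comp_smap_comp _ _ _ _ _
  | _, _, _, .op o V, _, _, r, hr, _, hk => by
      obtain ⟨v, hv, rfl⟩ := 𝓜.mem_comp_op.1 hk
      exact 𝓜.mem_comp_op.2 ⟨_, mem_val_subst V hr hv, (Category.assoc _ _ _).symm⟩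
  | _, _, _, .case (A := A) V M, _, _, r, hr, _, hk => by
      obtain ⟨v, hv, m, hm, rfl⟩ := 𝓜.mem_comp_case.1 hk
      exact 𝓜.mem_comp_case.2 ⟨_, mem_val_subst V hr hv, _,
        fun i => mem_comp_subst (M i) (hr.lift _) (hm i), 𝓜.comp_case r v m⟩
  | _, _, _, .handle M H N, _, _, r, hr, _, hk => by
      obtain ⟨m, hm, n, hn, h, hh, rfl⟩ := 𝓜.mem_comp_handle.1 hk
      obtain ⟨c, hc, e⟩ := 𝓜.mem_handler.1 hh
      refine 𝓜.mem_comp_handle.2 ⟨_, mem_comp_subst M hr hm, _, mem_comp_subst N (hr.lift _) hn,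
        h.comp r, ?_, ?_⟩
      · exact 𝓜.mem_handler.2 ⟨_, fun o => mem_comp_subst (H o) ((hr.lift _).lift _) (hc o),
          (congrArg (r ≫ ·) e).trans (𝓜.comp_tupleClauses r c).symm⟩
      · exact 𝓜.comp_handle_smap r h m n

end

theorem mem_comp_inst {Γ : Ctx Op Base} {A B : VTy Op Base} {𝒯 : EffTheory Op Base}
    {M : Comp (A :: Γ) B 𝒯} {V : Val Γ A} {m : 𝓜.ctx Γ ⊗ 𝓜.ty A ⟶ (𝓜.T 𝒯).obj (𝓜.ty B)}
    {v : 𝓜.ctx Γ ⟶ 𝓜.ty A} (hm : m ∈ 𝓜.comp M) (hv : v ∈ 𝓜.val V) :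
    CartesianMonoidalCategory.lift (𝟙 _) v ≫ m ∈ 𝓜.comp (M.inst V) :=
  mem_comp_subst M ((subSem_id Γ).cons hv) hm

theorem mem_comp_inst₂ {Γ : Ctx Op Base} {A A' B : VTy Op Base} {𝒯 : EffTheory Op Base}
    {M : Comp (A' :: A :: Γ) B 𝒯} {V : Val Γ A} {W : Val Γ A'}
    {m : (𝓜.ctx Γ ⊗ 𝓜.ty A) ⊗ 𝓜.ty A' ⟶ (𝓜.T 𝒯).obj (𝓜.ty B)}
    {v : 𝓜.ctx Γ ⟶ 𝓜.ty A} {w : 𝓜.ctx Γ ⟶ 𝓜.ty A'}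
    (hm : m ∈ 𝓜.comp M) (hv : v ∈ 𝓜.val V) (hw : w ∈ 𝓜.val W) :
    CartesianMonoidalCategory.lift (CartesianMonoidalCategory.lift (𝟙 _) v) w ≫ m ∈
      𝓜.comp (M.inst₂ V W) :=
  mem_comp_subst M (((subSem_id Γ).cons hv).cons hw) hm

/-! ### Effect theory terms -/

theorem GSubSem.lift {Δ : List (GTy Base)} {Γ : Ctx Op Base} {σ : GSub Δ Γ}
    {s : 𝓜.ctx Γ ⟶ 𝓜.gctx Δ} (h : 𝓜.GSubSem σ s) (B : GTy Base) :
    𝓜.GSubSem (Γ := B.toVTy Op :: Γ) (Δ := B :: Δ) (σ.lift B) (s ▷ 𝓜.gty B)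
  | _, .here => 𝓜.mem_val_var.2 (whiskerRight_snd _ _)
  | A, .there x =>
      mem_part_of_eq (whiskerRight_fst_assoc s _ (𝓜.gvar x))
        (mem_val_ren (σ A x) (renSem_wk Γ (B.toVTy Op)) (h A x))

theorem mem_val_inst {Δ : List (GTy Base)} {Γ : Ctx Op Base} {σ : GSub Δ Γ}
    {s : 𝓜.ctx Γ ⟶ 𝓜.gctx Δ} (h : 𝓜.GSubSem σ s) :
    {A : GTy Base} → (V : GTm Δ A) → s ≫ 𝓜.gtm V ∈ 𝓜.val (V.inst σ)
  | _, .var x => h _ x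
  | _, .tuple V => 𝓜.mem_val_tuple.2 ⟨_, fun i => mem_val_inst h (V i), comp_tuple _ _⟩
  | _, .proj (A := A) _ V => 𝓜.mem_val_proj.2 ⟨_, mem_val_inst h V, (Category.assoc _ _ _).symm⟩
  | _, .inj (A := A) _ V => 𝓜.mem_val_inj.2 ⟨_, mem_val_inst h V, (Category.assoc _ _ _).symm⟩

theorem mem_comp_etm_inst {𝒯 : EffTheory Op Base} : {Δ : List (GTy Base)} → {A : GTy Base} →
    (M : ETm 𝒯.sig Δ A) → {Γ : Ctx Op Base} → {σ : GSub Δ Γ} → {s : 𝓜.ctx Γ ⟶ 𝓜.gctx Δ} →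
    𝓜.GSubSem σ s → s ≫ 𝓜.etm 𝒯 (𝓜.op 𝒯) M ∈ 𝓜.comp (M.inst σ)
  | _, _, .ret V, _, _, _, h =>
      𝓜.mem_comp_ret.2 ⟨_, mem_val_inst h V, (Category.assoc _ _ _).symm⟩
  | _, _, .letOp o V M, _, _, s, h => by
      refine 𝓜.mem_comp_letIn.2 ⟨_, 𝓜.mem_comp_op.2 ⟨_, mem_val_inst h V, rfl⟩, _,
        mem_comp_etm_inst M (h.lift _), ?_⟩
      have := congrArg (· ≫ (𝓜.T 𝒯).μ.app _)
        ((𝓜.T 𝒯).comp_smap s (𝓜.gtm V ≫ 𝓜.op 𝒯 o) (𝓜.etm 𝒯 (𝓜.op 𝒯) M))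
      simp only [StrongMonad.smap, Category.assoc] at this ⊢
      exact this
  | _, _, .case V M, _, _, s, h =>
      𝓜.mem_comp_case.2 ⟨_, mem_val_inst h V, _, fun i => mem_comp_etm_inst (M i) (h.lift _),
        𝓜.comp_case _ _ _⟩

theorem mem_comp_etm_trans {S : Sig Op Base} {B : VTy Op Base} {𝒯' : EffTheory Op Base} :
    {Δ : List (GTy Base)} → {A : GTy Base} → (M : ETm S Δ A) → {Γ : Ctx Op Base} →
    {σ : GSub Δ Γ} → {s : 𝓜.ctx Γ ⟶ 𝓜.gctx Δ} → 𝓜.GSubSem σ s → {H : Hdl Γ S B 𝒯'} →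
    {h : 𝓜.ctx Γ ⟶ 𝓜.hdl S 𝒯' (𝓜.ty B)} → h ∈ 𝓜.handler H →
    {K : Val Γ (.fn (A.toVTy Op) B 𝒯')} →
    {k : 𝓜.ctx Γ ⟶ 𝓜.kexp 𝒯' (𝓜.gty A) (𝓜.ty B)} → k ∈ 𝓜.val K →
    CartesianMonoidalCategory.lift h (CartesianMonoidalCategory.lift s k) ≫
      𝓜.algUncurried 𝒯' (𝓜.ty B) M ∈ 𝓜.comp (M.trans σ H K)
  | _, _, .ret V, _, _, s, hs, _, h, hh, _, k, hk => by
      refine 𝓜.mem_comp_app.2 ⟨_, hk, _, mem_val_inst hs V, ?_⟩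
      change CartesianMonoidalCategory.lift h (CartesianMonoidalCategory.lift s k) ≫ snd _ _ ≫
        CartesianMonoidalCategory.lift (snd _ _) (fst _ _ ≫ 𝓜.gtm V) ≫ 𝓜.eval 𝒯' _ _ = _
      rw [lift_snd_assoc, comp_lift_assoc, lift_snd, lift_fst_assoc]
      rfl
  | _, _, .letOp o V M, Γ, _, s, hs, H, h, hh, _, k, hk => by
      obtain ⟨c, hc, e⟩ := 𝓜.mem_handler.1 hh
      have ih := mem_comp_etm_trans M (hs.lift _) (mem_handler_ren (renSem_wk Γ _) hh)
        (mem_val_ren _ (renSem_wk Γ _) hk)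
      refine mem_part_of_eq (𝓜.lift_algUncurried_letOp o V M h s k)
        (mem_part_of_eq ?_
          (mem_comp_inst₂ (hc o) (mem_val_inst hs V) (𝓜.mem_val_lam.2 ⟨_, ih, rfl⟩)))
      rw [e, ← Category.id_comp (𝓜.tupleClauses c), Category.assoc]
      exact 𝓜.tupleClauses_eval c o _ _ _
  | _, _, .case V M, Γ, _, s, hs, _, h, hh, _, k, hk => by
      refine 𝓜.mem_comp_case.2 ⟨_, mem_val_inst hs V, _, fun i =>
        mem_comp_etm_trans (M i) (hs.lift _) (mem_handler_ren (renSem_wk Γ _) hh)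
          (mem_val_ren _ (renSem_wk Γ _) hk), ?_⟩
      exact 𝓜.lift_algUncurried_case V M h s k

end Model
end EffHandlers

namespace EffHandlers
namespace Model

variable {Op : Type u₁} {Base : Type u₂} {C : Type u} [Category.{v} C]
  [CartesianMonoidalCategory C] {𝓜 : Model Op Base C}

/-- The interpretation of the context `Γ, Δ` as a product. -/
theorem exists_gctx_append (Γ : Ctx Op Base) : (Δ : List (GTy Base)) →
    ∃ (p : 𝓜.ctx (EffHandlers.gctx Op Δ ++ Γ) ⟶ 𝓜.ctx Γ)
      (q : 𝓜.ctx (EffHandlers.gctx Op Δ ++ Γ) ⟶ 𝓜.gctx Δ)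
      (j : 𝓜.ctx Γ ⊗ 𝓜.gctx Δ ⟶ 𝓜.ctx (EffHandlers.gctx Op Δ ++ Γ)),
      𝓜.RenSem (gwk Γ Δ) p ∧
      (∀ (A : GTy Base) (x : Var Δ A), q ≫ 𝓜.gvar x = 𝓜.var (EffHandlers.gvar Γ x)) ∧
      j ≫ p = fst _ _ ∧ j ≫ q = snd _ _
  | [] => ⟨𝟙 (𝓜.ctx Γ), toUnit _, fst _ _, fun _ _ => Category.id_comp _, fun _ x => (by cases x),
      Category.comp_id _, toUnit_unique _ _⟩
  | B :: Δ => by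
      obtain ⟨p, q, j, hp, hq, hjp, hjq⟩ := exists_gctx_append Γ Δ
      refine ⟨fst _ (𝓜.gty B) ≫ p, q ▷ 𝓜.gty B, (α_ _ _ _).inv ≫ (j ▷ 𝓜.gty B), ?_, ?_, ?_, ?_⟩
      · intro A x
        exact (Category.assoc _ _ _).trans (congrArg (fst _ _ ≫ ·) (hp A x))
      · rintro A (_ | x)
        · exact whiskerRight_snd _ _
        · exact (whiskerRight_fst_assoc _ _ _).trans (congrArg (fst _ _ ≫ ·) (hq A x))
      · have : ((α_ _ _ _).inv ≫ (j ▷ 𝓜.gty B)) ≫ fst _ (𝓜.gty B) ≫ p =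
            fst (𝓜.ctx Γ) (𝓜.gctx Δ ⊗ 𝓜.gty B) := by
          simp [hjp]
        exact this
      · have : ((α_ _ _ _).inv ≫ (j ▷ 𝓜.gty B)) ≫ (q ▷ 𝓜.gty B) =
            snd (𝓜.ctx Γ) (𝓜.gctx Δ ⊗ 𝓜.gty B) := by
          rw [Category.assoc, ← comp_whiskerRight, hjq]
          ext <;> simp
        exact this

theorem algUncurried_eq_of_mem {Γ : Ctx Op Base} {S : Sig Op Base} {B : VTy Op Base}
    {𝒯' : EffTheory Op Base} {H : Hdl Γ S B 𝒯'} {h : 𝓜.ctx Γ ⟶ 𝓜.hdl S 𝒯' (𝓜.ty B)}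
    (hh : h ∈ 𝓜.handler H) {Δ : List (GTy Base)} {A : GTy Base} {M N : ETm S Δ A}
    (e : 𝓜.comp (M.transK H) = 𝓜.comp (N.transK H)) :
    h ≫ 𝓜.alg 𝒯' (𝓜.ty B) M = h ≫ 𝓜.alg 𝒯' (𝓜.ty B) N := by
  obtain ⟨p, q, j, hp, hq, hjp, hjq⟩ := exists_gctx_append (𝓜 := 𝓜) Γ Δ
  have key (L : ETm S Δ A) :=
    mem_comp_etm_trans (𝓜 := 𝓜) L
      (Γ := .fn (A.toVTy Op) B 𝒯' :: (EffHandlers.gctx Op Δ ++ Γ))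
      (σ := fun _ x => .var (.there (EffHandlers.gvar Γ x)))
      (s := fst (𝓜.ctx (EffHandlers.gctx Op Δ ++ Γ)) (𝓜.ty (.fn (A.toVTy Op) B 𝒯')) ≫ q)
      (fun A x => 𝓜.mem_val_var.2
        ((Category.assoc _ _ _).trans (congrArg (fst _ _ ≫ ·) (hq A x))))
      (mem_handler_ren (ρ := fun _ x => .there (gwk Γ Δ _ x))
        (r := fst (𝓜.ctx (EffHandlers.gctx Op Δ ++ Γ)) (𝓜.ty (.fn (A.toVTy Op) B 𝒯')) ≫ p)
        (fun A x => (Category.assoc _ _ _).trans (congrArg (fst _ _ ≫ ·) (hp A x))) hh)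
      (K := .var .here) (k := snd _ _) (𝓜.mem_val_var.2 rfl)
  have e1 := Part.mem_unique (key M) (e ▸ key N)
  have e2 (a : 𝓜.hdl S 𝒯' (𝓜.ty B) ⊗ (𝓜.gctx Δ ⊗ 𝓜.kexp 𝒯' (𝓜.gty A) (𝓜.ty B)) ⟶
      (𝓜.T 𝒯').obj (𝓜.ty B)) :
      (h ▷ _) ≫ a = ((α_ _ _ _).inv ≫ (j ▷ _)) ≫
        CartesianMonoidalCategory.lift ((fst _ _ ≫ p) ≫ h)
          (CartesianMonoidalCategory.lift (fst _ _ ≫ q) (snd _ _)) ≫ a := by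
    rw [comp_lift_assoc, comp_lift]
    congr 1
    ext <;> simp [hjq, reassoc_of% hjp]
  simp only [PreModel.alg, ← 𝓜.curry_natural]
  congr 1
  exact (e2 _).trans ((congrArg (_ ≫ ·) e1).trans (e2 _).symm)

end Model
end EffHandlers

namespace EffHandlers
namespace Model

variable {Op : Type u₁} {Base : Type u₂} {C : Type u} [Category.{v} C]
  [CartesianMonoidalCategory C] {𝓜 : Model Op Base C}

theorem exists_gsubSem {Γ : Ctx Op Base} : {Δ : List (GTy Base)} → (σ : GSub Δ Γ) →
    (∀ (A : GTy Base) (x : Var Δ A), ∃ v, v ∈ 𝓜.val (σ A x)) → ∃ s, 𝓜.GSubSem σ s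
  | [], _, _ => ⟨toUnit _, fun _ x => by cases x⟩
  | B :: Δ, σ, h => by
      obtain ⟨s, hs⟩ := exists_gsubSem (fun A x => σ A (.there x)) fun A x => h A (.there x)
      obtain ⟨b, hb⟩ := h B .here
      refine ⟨CartesianMonoidalCategory.lift s b, ?_⟩
      rintro A (_ | x)
      · exact mem_part_of_eq (lift_snd _ _) hb
      · exact mem_part_of_eq (lift_fst_assoc _ _ _) (hs A x)

/-- Two partial elements are defined and equal. -/
def DefEq {α : Type v} (p q : Part α) : Prop := ∃ a, a ∈ p ∧ a ∈ q

theorem DefEq.eq {α : Type v} {p q : Part α} (h : DefEq p q) : p = q := by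
  obtain ⟨a, hp, hq⟩ := h
  rw [Part.eq_some_iff.2 hp, Part.eq_some_iff.2 hq]

theorem DefEq.symm {α : Type v} {p q : Part α} (h : DefEq p q) : DefEq q p := by
  obtain ⟨a, hp, hq⟩ := h
  exact ⟨a, hq, hp⟩

theorem DefEq.trans {α : Type v} {p q r : Part α} (h : DefEq p q) (h' : DefEq q r) :
    DefEq p r := h'.eq ▸ h

theorem DefEq.dom_and_eq {α : Type v} {p q : Part α} (h : DefEq p q) :
    p.Dom ∧ q.Dom ∧ p = q := by
  refine ⟨?_, ?_, h.eq⟩ <;> obtain ⟨a, hp, hq⟩ := h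
  · exact Part.dom_iff_mem.2 ⟨a, hp⟩
  · exact Part.dom_iff_mem.2 ⟨a, hq⟩

mutual

theorem exists_mem_val : {Γ : Ctx Op Base} → {A : VTy Op Base} → {V : Val Γ A} → WTVal V →
    ∃ v, v ∈ 𝓜.val V
  | _, _, _, .var x => ⟨_, 𝓜.mem_val_var.2 rfl⟩
  | _, _, _, .lam hM => by
      obtain ⟨m, hm⟩ := exists_mem_comp hM
      exact ⟨_, 𝓜.mem_val_lam.2 ⟨m, hm, rfl⟩⟩
  | _, _, _, .tuple hV => by
      choose v hv using fun i => exists_mem_val (hV i)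
      exact ⟨_, 𝓜.mem_val_tuple.2 ⟨v, hv, rfl⟩⟩
  | _, _, _, .proj (A := A) i hV => by
      obtain ⟨v, hv⟩ := exists_mem_val hV
      exact ⟨_, 𝓜.mem_val_proj.2 ⟨v, hv, rfl⟩⟩
  | _, _, _, .inj (A := A) i hV => by
      obtain ⟨v, hv⟩ := exists_mem_val hV
      exact ⟨_, 𝓜.mem_val_inj.2 ⟨v, hv, rfl⟩⟩
termination_by structural _ _ _ h => h

theorem exists_mem_comp : {Γ : Ctx Op Base} → {A : VTy Op Base} → {𝒯 : EffTheory Op Base} →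
    {M : Comp Γ A 𝒯} → WTComp M → ∃ m, m ∈ 𝓜.comp M
  | _, _, _, _, .app hV hW => by
      obtain ⟨v, hv⟩ := exists_mem_val hV
      obtain ⟨w, hw⟩ := exists_mem_val hW
      exact ⟨_, 𝓜.mem_comp_app.2 ⟨v, hv, w, hw, rfl⟩⟩
  | _, _, _, _, .ret hV => by
      obtain ⟨v, hv⟩ := exists_mem_val hV
      exact ⟨_, 𝓜.mem_comp_ret.2 ⟨v, hv, rfl⟩⟩
  | _, _, _, _, .letIn hM hN => by
      obtain ⟨m, hm⟩ := exists_mem_comp hM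
      obtain ⟨n, hn⟩ := exists_mem_comp hN
      exact ⟨_, 𝓜.mem_comp_letIn.2 ⟨m, hm, n, hn, rfl⟩⟩
  | _, _, _, _, .op o hV => by
      obtain ⟨v, hv⟩ := exists_mem_val hV
      exact ⟨_, 𝓜.mem_comp_op.2 ⟨v, hv, rfl⟩⟩
  | _, _, _, _, .case hV hM => by
      obtain ⟨v, hv⟩ := exists_mem_val hV
      choose m hm using fun i => exists_mem_comp (hM i)
      exact ⟨_, 𝓜.mem_comp_case.2 ⟨v, hv, m, hm, rfl⟩⟩
  | _, _, _, _, .handle hM hH hN => by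
      obtain ⟨m, hm⟩ := exists_mem_comp hM
      obtain ⟨h, hh⟩ := exists_mem_handler_sat hH
      obtain ⟨n, hn⟩ := exists_mem_comp hN
      exact ⟨_, 𝓜.mem_comp_handle.2 ⟨m, hm, n, hn, h, hh, rfl⟩⟩
termination_by structural _ _ _ _ h => h

theorem exists_mem_handler : {Γ : Ctx Op Base} → {S : Sig Op Base} → {B : VTy Op Base} →
    {𝒯' : EffTheory Op Base} → {H : Hdl Γ S B 𝒯'} → WTHdl H → ∃ h, h ∈ 𝓜.handler H
  | _, _, _, _, _, .mk hH => by
      choose c hc using fun o => exists_mem_comp (hH o)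
      exact ⟨_, 𝓜.mem_handler.2 ⟨c, hc, rfl⟩⟩
termination_by structural _ _ _ _ _ h => h

theorem exists_mem_handler_sat : {Γ : Ctx Op Base} → {𝒯 : EffTheory Op Base} →
    {B : VTy Op Base} → {𝒯' : EffTheory Op Base} → {H : Hdl Γ 𝒯.sig B 𝒯'} → Respects 𝒯 H →
    ∃ h : 𝓜.HSat 𝒯 𝒯' (𝓜.ty B) (𝓜.ctx Γ), h.1 ∈ 𝓜.handler H
  | _, _, _, _, _, .mk hH hE => by
      obtain ⟨h, hh⟩ := exists_mem_handler hH
      exact ⟨⟨h, fun a ha => algUncurried_eq_of_mem hh (defEq_comp (hE a ha)).eq⟩, hh⟩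
termination_by structural _ _ _ _ _ h => h

theorem defEq_val : {Γ : Ctx Op Base} → {A : VTy Op Base} → {V W : Val Γ A} → EqVal V W →
    DefEq (𝓜.val V) (𝓜.val W)
  | _, _, _, _, .refl hV => by
      obtain ⟨v, hv⟩ := exists_mem_val hV
      exact ⟨v, hv, hv⟩
  | _, _, _, _, .symm h => (defEq_val h).symm
  | _, _, _, _, .trans h h' => (defEq_val h).trans (defEq_val h')
  | _, _, _, _, .lam h => by
      obtain ⟨m, hm, hm'⟩ := defEq_comp h
      exact ⟨_, 𝓜.mem_val_lam.2 ⟨m, hm, rfl⟩, 𝓜.mem_val_lam.2 ⟨m, hm', rfl⟩⟩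
  | _, _, _, _, .tuple h => by
      choose v hv hv' using fun i => defEq_val (h i)
      exact ⟨_, 𝓜.mem_val_tuple.2 ⟨v, hv, rfl⟩, 𝓜.mem_val_tuple.2 ⟨v, hv', rfl⟩⟩
  | _, _, _, _, .proj (A := A) i h => by
      obtain ⟨v, hv, hv'⟩ := defEq_val h
      exact ⟨_, 𝓜.mem_val_proj.2 ⟨v, hv, rfl⟩, 𝓜.mem_val_proj.2 ⟨v, hv', rfl⟩⟩
  | _, _, _, _, .inj (A := A) i h => by
      obtain ⟨v, hv, hv'⟩ := defEq_val h
      exact ⟨_, 𝓜.mem_val_inj.2 ⟨v, hv, rfl⟩, 𝓜.mem_val_inj.2 ⟨v, hv', rfl⟩⟩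
  | Γ, _, _, _, .lam_eta (A := A) hV => by
      obtain ⟨v, hv⟩ := exists_mem_val hV
      refine ⟨v, hv, 𝓜.mem_val_lam.2 ⟨_, 𝓜.mem_comp_app.2 ⟨_, mem_val_ren _ (renSem_wk Γ A) hv, _,
        𝓜.mem_val_var.2 rfl, rfl⟩, ?_⟩⟩
      refine (𝓜.curry_eta v).symm.trans (congrArg _ (congrArg (· ≫ 𝓜.eval _ _ _) ?_))
      exact CartesianMonoidalCategory.hom_ext _ _
        ((whiskerRight_fst _ _).trans (lift_fst _ _).symm)
        ((whiskerRight_snd _ _).trans (lift_snd _ _).symm)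
  | _, _, _, _, .prod_beta (A := A) (V := V) i hV => by
      choose v hv using fun i => exists_mem_val (hV i)
      exact ⟨v i, 𝓜.mem_val_proj.2 ⟨_, 𝓜.mem_val_tuple.2 ⟨v, hv, rfl⟩, (Pi.lift_π v i).symm⟩, hv i⟩
  | _, _, _, _, .prod_eta hV => by
      obtain ⟨v, hv⟩ := exists_mem_val hV
      exact ⟨v, hv,
        𝓜.mem_val_tuple.2 ⟨_, fun i => 𝓜.mem_val_proj.2 ⟨v, hv, rfl⟩, tuple_eta _ v⟩⟩
termination_by structural _ _ _ _ h => h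

theorem defEq_comp : {Γ : Ctx Op Base} → {A : VTy Op Base} → {𝒯 : EffTheory Op Base} →
    {M N : Comp Γ A 𝒯} → EqComp M N → DefEq (𝓜.comp M) (𝓜.comp N)
  | _, _, _, _, _, .refl hM => by
      obtain ⟨m, hm⟩ := exists_mem_comp hM
      exact ⟨m, hm, hm⟩
  | _, _, _, _, _, .symm h => (defEq_comp h).symm
  | _, _, _, _, _, .trans h h' => (defEq_comp h).trans (defEq_comp h')
  | _, _, _, _, _, .app h h' => by
      obtain ⟨v, hv, hv'⟩ := defEq_val h
      obtain ⟨w, hw, hw'⟩ := defEq_val h'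
      exact ⟨_, 𝓜.mem_comp_app.2 ⟨v, hv, w, hw, rfl⟩, 𝓜.mem_comp_app.2 ⟨v, hv', w, hw', rfl⟩⟩
  | _, _, _, _, _, .ret h => by
      obtain ⟨v, hv, hv'⟩ := defEq_val h
      exact ⟨_, 𝓜.mem_comp_ret.2 ⟨v, hv, rfl⟩, 𝓜.mem_comp_ret.2 ⟨v, hv', rfl⟩⟩
  | _, _, _, _, _, .letIn h h' => by
      obtain ⟨m, hm, hm'⟩ := defEq_comp h
      obtain ⟨n, hn, hn'⟩ := defEq_comp h'
      exact ⟨_, 𝓜.mem_comp_letIn.2 ⟨m, hm, n, hn, rfl⟩,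
        𝓜.mem_comp_letIn.2 ⟨m, hm', n, hn', rfl⟩⟩
  | _, _, _, _, _, .op o h => by
      obtain ⟨v, hv, hv'⟩ := defEq_val h
      exact ⟨_, 𝓜.mem_comp_op.2 ⟨v, hv, rfl⟩, 𝓜.mem_comp_op.2 ⟨v, hv', rfl⟩⟩
  | _, _, _, _, _, .case h h' => by
      obtain ⟨v, hv, hv'⟩ := defEq_val h
      choose m hm hm' using fun i => defEq_comp (h' i)
      exact ⟨_, 𝓜.mem_comp_case.2 ⟨v, hv, m, hm, rfl⟩, 𝓜.mem_comp_case.2 ⟨v, hv', m, hm', rfl⟩⟩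
  | _, _, _, _, _, .handle hM hH hR hN => by
      obtain ⟨m, hm, hm'⟩ := defEq_comp hM
      obtain ⟨n, hn, hn'⟩ := defEq_comp hN
      obtain ⟨h, hh⟩ := exists_mem_handler_sat hR
      have e := (defEq_handler hH).eq
      exact ⟨_, 𝓜.mem_comp_handle.2 ⟨m, hm, n, hn, h, hh, rfl⟩,
        𝓜.mem_comp_handle.2 ⟨m, hm', n, hn', h, e ▸ hh, rfl⟩⟩
  | _, _, _, _, _, .lam_beta hM hV => by
      obtain ⟨m, hm⟩ := exists_mem_comp hM
      obtain ⟨v, hv⟩ := exists_mem_val hV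
      refine ⟨_, 𝓜.mem_comp_app.2 ⟨_, 𝓜.mem_val_lam.2 ⟨m, hm, rfl⟩, v, hv, ?_⟩,
        mem_comp_inst hm hv⟩
      exact (𝓜.lift_id_curry_eval m v).symm
  | _, _, _, _, _, .sum_beta (A := A) i hV hM => by
      obtain ⟨v, hv⟩ := exists_mem_val hV
      choose m hm using fun i => exists_mem_comp (hM i)
      refine ⟨_, 𝓜.mem_comp_case.2 ⟨_, 𝓜.mem_val_inj.2 ⟨v, hv, rfl⟩, m, hm, ?_⟩,
        mem_comp_inst (hm i) hv⟩
      exact (𝓜.lift_inj_cotuple _ m i v).symm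
  | Γ, _, _, _, _, .sum_eta (A := A) hV hM => by
      obtain ⟨v, hv⟩ := exists_mem_val hV
      obtain ⟨m, hm⟩ := exists_mem_comp hM
      refine ⟨_, 𝓜.mem_comp_case.2 ⟨v, hv, _, fun i => mem_comp_subst _ ((subSem_wk Γ (A i)).cons
        (𝓜.mem_val_inj.2 ⟨_, 𝓜.mem_val_var.2 rfl, rfl⟩)) hm, ?_⟩, mem_comp_inst hm hv⟩
      exact congrArg (CartesianMonoidalCategory.lift _ _ ≫ ·)
        (𝓜.cotuple_unique _ _ m fun i => congrArg (· ≫ m) (whiskerLeft_eq_lift _ _))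
  | _, _, _, _, _, .let_beta hV hM => by
      obtain ⟨v, hv⟩ := exists_mem_val hV
      obtain ⟨m, hm⟩ := exists_mem_comp hM
      exact ⟨_, 𝓜.mem_comp_letIn.2 ⟨_, 𝓜.mem_comp_ret.2 ⟨v, hv, rfl⟩, m, hm,
        ((𝓜.T _).smap_eta_mu v m).symm⟩, mem_comp_inst hm hv⟩
  | _, _, _, _, _, .let_eta hM => by
      obtain ⟨m, hm⟩ := exists_mem_comp hM
      exact ⟨m, 𝓜.mem_comp_letIn.2 ⟨m, hm, _, 𝓜.mem_comp_ret.2 ⟨_, 𝓜.mem_val_var.2 rfl, rfl⟩,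
        ((𝓜.T _).smap_snd_eta_mu m).symm⟩, hm⟩
  | Γ, _, _, _, _, .let_assoc (A₁ := A₁) (A₂ := A₂) hM hN hL => by
      obtain ⟨m, hm⟩ := exists_mem_comp hM
      obtain ⟨n, hn⟩ := exists_mem_comp hN
      obtain ⟨l, hl⟩ := exists_mem_comp hL
      exact ⟨_, 𝓜.mem_comp_letIn.2 ⟨_, 𝓜.mem_comp_letIn.2 ⟨m, hm, n, hn, rfl⟩, l, hl, rfl⟩,
        𝓜.mem_comp_letIn.2 ⟨m, hm, _, 𝓜.mem_comp_letIn.2 ⟨n, hn, _,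
          mem_comp_ren _ ((renSem_wk Γ A₁).lift A₂) hl, rfl⟩, (𝓜.T _).smap_assoc m n l⟩⟩
  | _, _, _, _, _, .handle_ret hV hM hH => by
      obtain ⟨v, hv⟩ := exists_mem_val hV
      obtain ⟨m, hm⟩ := exists_mem_comp hM
      obtain ⟨h, hh⟩ := exists_mem_handler_sat hH
      exact ⟨_, 𝓜.mem_comp_handle.2 ⟨_, 𝓜.mem_comp_ret.2 ⟨v, hv, rfl⟩, m, hm, h, hh,
        (𝓜.handle_smap_unit h v m).symm⟩, mem_comp_inst hm hv⟩
  | Γ, _, _, _, _, .handle_let (A := A) (A' := A') hH hL hM hN => by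
      obtain ⟨h, hh⟩ := exists_mem_handler_sat hH
      obtain ⟨l, hl⟩ := exists_mem_comp hL
      obtain ⟨m, hm⟩ := exists_mem_comp hM
      obtain ⟨n, hn⟩ := exists_mem_comp hN
      exact ⟨_, 𝓜.mem_comp_handle.2 ⟨_, 𝓜.mem_comp_letIn.2 ⟨l, hl, m, hm, rfl⟩, n, hn, h, hh, rfl⟩,
        𝓜.mem_comp_handle.2 ⟨l, hl, _, 𝓜.mem_comp_handle.2 ⟨m, hm, _,
          mem_comp_ren _ ((renSem_wk Γ A).lift A') hn, h.comp (fst _ _),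
          mem_handler_ren (renSem_wk Γ A) hh, rfl⟩, h, hh, 𝓜.handle_smap_mult h l m n⟩⟩
  | _, _, _, _, _, .handle_op o hH hM hV => by
      obtain ⟨h, hh⟩ := exists_mem_handler_sat hH
      obtain ⟨m, hm⟩ := exists_mem_comp hM
      obtain ⟨v, hv⟩ := exists_mem_val hV
      obtain ⟨c, hc, e⟩ := 𝓜.mem_handler.1 hh
      refine ⟨_, 𝓜.mem_comp_handle.2 ⟨_, 𝓜.mem_comp_op.2 ⟨v, hv, rfl⟩, m, hm, h, hh, ?_⟩,
        mem_comp_inst₂ (hc o) hv (𝓜.mem_val_lam.2 ⟨m, hm, rfl⟩)⟩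
      exact (𝓜.handle_smap_op_tupleClauses h c e o v m).symm
  | _, _, _, _, _, .inst_ax a σ ha hσ => by
      obtain ⟨s, hs⟩ := exists_gsubSem (𝓜 := 𝓜) σ fun A x => exists_mem_val (hσ A x)
      exact ⟨_, mem_comp_etm_inst a.lhs hs,
        mem_part_of_eq (congrArg (s ≫ ·) (𝓜.op_sat _ a ha)) (mem_comp_etm_inst a.rhs hs)⟩
termination_by structural _ _ _ _ _ h => h

theorem defEq_handler : {Γ : Ctx Op Base} → {S : Sig Op Base} → {B : VTy Op Base} →
    {𝒯' : EffTheory Op Base} → {H H' : Hdl Γ S B 𝒯'} → EqHdl H H' →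
    DefEq (𝓜.handler H) (𝓜.handler H')
  | _, _, _, _, _, _, .refl hH => by
      obtain ⟨h, hh⟩ := exists_mem_handler hH
      exact ⟨h, hh, hh⟩
  | _, _, _, _, _, _, .symm h => (defEq_handler h).symm
  | _, _, _, _, _, _, .trans h h' => (defEq_handler h).trans (defEq_handler h')
  | _, _, _, _, _, _, .congr h => by
      choose c hc hc' using fun o => defEq_comp (h o)
      exact ⟨_, 𝓜.mem_handler.2 ⟨c, hc, rfl⟩, 𝓜.mem_handler.2 ⟨c, hc', rfl⟩⟩
termination_by structural _ _ _ _ _ _ h => h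

end

end Model
end EffHandlers

theorem mainTheorem4 {Op : Type u₁} {Base : Type u₂} {C : Type u} [Category.{v} C]
    [CartesianMonoidalCategory C] (𝓜 : EffHandlers.Model Op Base C) :
    (∀ (Γ : EffHandlers.Ctx Op Base) (A : EffHandlers.VTy Op Base) (V : EffHandlers.Val Γ A),
      EffHandlers.WTVal V → (𝓜.val V).Dom) ∧
    (∀ (Γ : EffHandlers.Ctx Op Base) (A : EffHandlers.VTy Op Base)
      (𝒯 : EffHandlers.EffTheory Op Base) (M : EffHandlers.Comp Γ A 𝒯),
      EffHandlers.WTComp M → (𝓜.comp M).Dom) ∧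
    (∀ (Γ : EffHandlers.Ctx Op Base) (S : EffHandlers.Sig Op Base) (B : EffHandlers.VTy Op Base)
      (𝒯' : EffHandlers.EffTheory Op Base) (H : EffHandlers.Hdl Γ S B 𝒯'),
      EffHandlers.WTHdl H → (𝓜.handler H).Dom) ∧
    (∀ (Γ : EffHandlers.Ctx Op Base) (A : EffHandlers.VTy Op Base) (V W : EffHandlers.Val Γ A),
      EffHandlers.EqVal V W → (𝓜.val V).Dom ∧ (𝓜.val W).Dom ∧ 𝓜.val V = 𝓜.val W) ∧
    (∀ (Γ : EffHandlers.Ctx Op Base) (A : EffHandlers.VTy Op Base)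
      (𝒯 : EffHandlers.EffTheory Op Base) (M N : EffHandlers.Comp Γ A 𝒯),
      EffHandlers.EqComp M N → (𝓜.comp M).Dom ∧ (𝓜.comp N).Dom ∧ 𝓜.comp M = 𝓜.comp N) ∧
    (∀ (Γ : EffHandlers.Ctx Op Base) (S : EffHandlers.Sig Op Base) (B : EffHandlers.VTy Op Base)
      (𝒯' : EffHandlers.EffTheory Op Base) (H H' : EffHandlers.Hdl Γ S B 𝒯'),
      EffHandlers.EqHdl H H' →
        (𝓜.handler H).Dom ∧ (𝓜.handler H').Dom ∧ 𝓜.handler H = 𝓜.handler H') :=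
  ⟨fun _ _ _ h => Part.dom_iff_mem.2 (EffHandlers.Model.exists_mem_val h),
    fun _ _ _ _ h => Part.dom_iff_mem.2 (EffHandlers.Model.exists_mem_comp h),
    fun _ _ _ _ _ h => Part.dom_iff_mem.2 (EffHandlers.Model.exists_mem_handler h),
    fun _ _ _ _ h => (EffHandlers.Model.defEq_val h).dom_and_eq,
    fun _ _ _ _ _ h => (EffHandlers.Model.defEq_comp h).dom_and_eq,
    fun _ _ _ _ _ _ h => (EffHandlers.Model.defEq_handler h).dom_and_eq⟩
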